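/- Let $K$ be an arbitrary field, let $n,m\ge 1$, let $x=(x_1,\dots,x_n)$, $y=(y_1,y_2)$ and $t$ be indeterminates, and let $K(x)$ be the fraction field of the polynomial ring $K[x]$. For a tuple $F=(F_1,\dots,F_r)$ of rational functions (in $x$ or in $y$), $K(tF)$ denotes the field generated over $K$ by $tF_1,\dots,tF_r$. A tuple of polynomials (over $K$, in $x$ or in $y$) is *primitive* if every common divisor of its components is a unit of the polynomial ring; it is *homogeneous* if, for some $d$, all its nonzero components are homogeneous of degree $d$; it is *constant* if all its components lie in $K$. For a nonzero tuple $F$ of polynomials, $\deg F$ and $\operatorname{ldeg}F$ denote the largest and the smallest degree of a term occurring in a component of $F$. Let $H\in K(x)^m$ satisfy $\operatorname{trdeg}_K K(tH)\le 2$. Then there are $g\in K(x)$, $h\in K[y_1,y_2]^m$ and $p,q\in K[x]$ such that - (i) $H=g\cdot h(p,q)$ and $g\ne 0$; - (ii) $h$ is either homogeneous and primitive, or zero; - (iii) $(p,q)$ is primitive, but not constant. Moreover, for all $g,h,p,q$ that satisfy (i), (ii) and (iii), the following hold. - (iv) $\operatorname{trdeg}_K K(tH)=\operatorname{trdeg}_K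 K(t\,h(p,q))=\operatorname{trdeg}_K K(th)$. - (v) $H\ne0\iff h(p,q)$ is primitive $\iff h$ is primitive $\iff h\neq 0$. - (vi) $\operatorname{trdeg}_K K(tH)\le 1\iff h(p,q)\in K^m\iff h\in K^m$. - (vii) If $h\ne0$, then $\deg h=\operatorname{ldeg}h=:s$, and $\deg h(p,q)=s\cdot\deg(p,q)$ and $\operatorname{ldeg}h(p,q)=s\cdot\operatorname{ldeg}(p,q)$. - (viii) If $h\ne0$, then $h(p,q)$ is homogeneous if and only if $h\in K^m$ or $(p,q)$ is homogeneous. In particular, if $h\notin K^m$, then $h(p,q)$ is homogeneous if and only if $(p,q)$ is homogeneous. - (ix) If $\deg(p,q)$ is minimal among all $(g,h,p,q)$ that satisfy (i), (ii) and (iii) for the given $H$, then $K(p/q)$ is algebraically closed in $K(x)$. -/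

import Mathlib

open MvPolynomial

/-- The field of rational functions `K(x) = K(x₁, …, xₙ)`. -/
abbrev RatField (n : ℕ) (K : Type*) [Field K] : Type _ :=
  FractionRing (MvPolynomial (Fin n) K)

/-- `trdeg_K K(tH)`, where `H` is a tuple over an extension field `F` of `K` and `t` is an
indeterminate over `F`; the field `K(tH)` is the subfield of `F(t)` generated over `K` by the
products `t * H i`. -/
noncomputable def trdegT (K : Type*) {F ι : Type*} [Field K] [Field F] [Algebra K F]
    (H : ι → F) : Cardinal :=
  Algebra.trdeg K
    (IntermediateField.adjoin K (Set.range fun i => (RatFunc.X * RatFunc.C (H i) : RatFunc F)))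

/-- A tuple of elements of a commutative ring is primitive if every common divisor of its
components is a unit. -/
def IsPrimitiveTuple {R ι : Type*} [CommRing R] (H : ι → R) : Prop :=
  ∀ d : R, (∀ i, d ∣ H i) → IsUnit d

/-- For a domain `R` that is not a field, primitivity as it reads in the fraction field `L`
of `R`: for all nonzero `g ∈ R`, all components of `g⁻¹ H` lie in `R` if and only if
`g⁻¹` lies in `R`. -/
theorem isPrimitiveTuple_iff {R L ι : Type*} [CommRing R] [IsDomain R] [Field L] [Algebra R L]
    [IsFractionRing R L] (hR : ¬ IsField R) (H : ι → R) :
    IsPrimitiveTuple H ↔ ∀ g : R, g ≠ 0 →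
      ((∀ i, ∃ r : R, algebraMap R L r = (algebraMap R L g)⁻¹ * algebraMap R L (H i)) ↔
        ∃ r : R, algebraMap R L r = (algebraMap R L g)⁻¹) := by
  constructor
  · intro hP g hg
    have hg' : algebraMap R L g ≠ 0 := by simpa using hg
    constructor
    · intro hd
      obtain ⟨b, hb⟩ := (hP g (fun i => by
        obtain ⟨r, hr⟩ := hd i
        refine ⟨r, IsFractionRing.injective R L ?_⟩
        rw [map_mul, hr, mul_inv_cancel_left₀ hg'])).exists_right_inv
      refine ⟨b, eq_inv_of_mul_eq_one_right ?_⟩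
      rw [← map_mul, hb, map_one]
    · rintro ⟨r, hr⟩ i
      exact ⟨r * H i, by rw [map_mul, hr]⟩
  · intro hP d hd
    by_cases h0 : d = 0
    · exfalso
      have hH : ∀ i, H i = 0 := fun i => zero_dvd_iff.1 (h0 ▸ hd i)
      refine hR ⟨⟨0, 1, zero_ne_one⟩, mul_comm, fun {g} hg => ?_⟩
      have hg' : algebraMap R L g ≠ 0 := by simpa using hg
      obtain ⟨r, hr⟩ := (hP g hg).1 (fun i => ⟨0, by simp [hH i]⟩)
      exact ⟨r, IsFractionRing.injective R L (by rw [map_mul, hr, map_one, mul_inv_cancel₀ hg'])⟩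
    · have hd' : algebraMap R L d ≠ 0 := by simpa using h0
      obtain ⟨r, hr⟩ := (hP d h0).1 (fun i => by
        obtain ⟨r, hr⟩ := hd i
        exact ⟨r, by rw [hr, map_mul, inv_mul_cancel_left₀ hd']⟩)
      refine IsUnit.of_mul_eq_one r (IsFractionRing.injective R L ?_)
      rw [map_mul, hr, map_one, mul_inv_cancel₀ hd']

/-- The tuple `h(p, q)`. -/
noncomputable def substPair {K σ ι : Type*} [Field K] (h : ι → MvPolynomial (Fin 2) K)
    (p q : MvPolynomial σ K) : ι → MvPolynomial σ K :=
  fun i => aeval ![p, q] (h i)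

/-- The tuple `F` is constant, i.e. `F ∈ K^ι`. -/
def IsConstTuple {K σ ι : Type*} [Field K] (F : ι → MvPolynomial σ K) : Prop :=
  ∃ c : ι → K, ∀ i, F i = C (c i)

/-- The tuple `F` is homogeneous: for some `s`, each component is homogeneous of degree `s`
(or zero). -/
def IsHomogTuple {K σ ι : Type*} [Field K] (F : ι → MvPolynomial σ K) : Prop :=
  ∃ s : ℕ, ∀ i, (F i).IsHomogeneous s

/-- The largest degree of a term of the tuple `F`; it is `⊥` (that is, `-∞`) for `F = 0`. -/
noncomputable def tupleDeg {K σ ι : Type*} [Field K] [Fintype ι] (F : ι → MvPolynomial σ K) : WithBot ℕ :=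
  Finset.univ.sup fun i => (F i).support.sup fun d => ((d.degree : ℕ) : WithBot ℕ)

/-- The smallest degree of a term of the tuple `F`; it is `⊤` (that is, `+∞`) for `F = 0`. -/
noncomputable def tupleLowDeg {K σ ι : Type*} [Field K] [Fintype ι] (F : ι → MvPolynomial σ K) : ℕ∞ :=
  Finset.univ.inf fun i => (F i).support.inf fun d => ((d.degree : ℕ) : ℕ∞)

/-- `H = g · h(p, q)`, with `g ≠ 0`, with `h` homogeneous and primitive or zero, and with `(p, q)`
primitive and not constant. -/
structure IsPairForm {K : Type*} [Field K] {n m : ℕ} (H : Fin m → RatField n K)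
    (g : RatField n K) (h : Fin m → MvPolynomial (Fin 2) K) (p q : MvPolynomial (Fin n) K) :
    Prop where
  eq : ∀ i, H i = g * algebraMap (MvPolynomial (Fin n) K) (RatField n K) (substPair h p q i)
  g_ne_zero : g ≠ 0
  homog_or_zero : (IsHomogTuple h ∧ IsPrimitiveTuple h) ∨ h = 0
  pair_primitive : IsPrimitiveTuple ![p, q]
  pair_not_const : ¬ IsConstTuple ![p, q]

-- Existence. For a nonzero component `H i₀`, let L be the field generated over K by the ratios `H i
-- / H i₀`. Then K(tH) = L(t `H i₀`), and t `H i₀` is transcendental over K(x), so the hypothesis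
-- says that L has transcendence degree at most one (`trdegT_eq_add_one`). By Gordan and Igusa
-- (`RatField.exists_eq_adjoin_of_trdeg_le_one`), L = K(z). Write z = p/q in lowest terms, or take
-- any coprime nonconstant pair if z is constant. The ratios are then fractions of polynomials in
-- p/q. Clearing denominators and homogenizing turns them into forms in p and q, whose gcd is moved
-- into g (`exists_isPairForm_of_div_mem`).
--
-- Gordan–Igusa: the polynomials over L vanishing at x form a principal ideal (P). Let g = a/b be a
-- nonconstant element of L of least degree, and let Q be a multiple of P by a scalar of K(x), with
-- coefficients in K[x] and no factor in K[x]. Then Q divides b(x)a(X) - a(x)b(X). Both have the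
-- same degree in x, because two coefficients of Q have a nonconstant ratio in L. So the quotient is
-- some w(X), and for f = u/v in L, a(X) - g b(X) divides w(X)(u(X) - f v(X)). A K(g)-linear
-- functional that kills f but not 1 would contradict this if f were outside K(g).
--
-- The properties rest on one fact: the ideal of a primitive homogeneous tuple in two variables
-- contains powers of both variables (`exists_pow_mem_of_aeval_mem`). Modulo a common divisor of
-- h(p,q), it shows that h(p,q) is primitive; modulo zero, that h has no common zero except the
-- origin. Hence the extreme homogeneous components of (p,q) survive substitution into h, which
-- gives the degree formulas and the criteria for constancy and homogeneity. The transcendence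
-- degrees agree since h(p,q) = q^s h(p/q, 1) with p/q transcendental.
--
-- Algebraic closedness: the algebraic closure of K(p/q) in K(x) has transcendence degree one, so it
-- lies in some K(p'/q'). Then (p,q) = k(p',q') with k primitive homogeneous, and h(k) with (p',q')
-- represents H too. Minimality of the degree forces k to be linear, hence invertible, so K(p'/q')
-- is contained in K(p/q).

universe u

/-! ### Algebraic elements of K(x) and vanishing ideals -/

theorem RatField.exists_algebraMap_eq_of_isAlgebraic {n : ℕ} {K : Type*} [Field K]
    {z : RatField n K} (hz : IsAlgebraic K z) : ∃ c : K, algebraMap K (RatField n K) c = z := by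
  by_cases h0 : z = 0
  · exact ⟨0, by simp [h0]⟩
  -- K[x] is integrally closed, so both z and its inverse are polynomials; thus z is a unit of K[x].
  have key : ∀ w : RatField n K, IsAlgebraic K w →
      ∃ r : MvPolynomial (Fin n) K, algebraMap _ (RatField n K) r = w := fun w hw =>
    IsIntegrallyClosed.isIntegral_iff.1 (hw.isIntegral.tower_top (A := MvPolynomial (Fin n) K))
  obtain ⟨r, hr⟩ := key z hz
  obtain ⟨s, hs⟩ := key z⁻¹ hz.inv
  have hu : IsUnit r := IsUnit.of_mul_eq_one s <|
    IsFractionRing.injective (MvPolynomial (Fin n) K) (RatField n K) (by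
      rw [map_mul, hr, hs, map_one, mul_inv_cancel₀ h0])
  obtain ⟨c, -, rfl⟩ := isUnit_iff_eq_C_of_isReduced.1 hu
  exact ⟨c, by rw [← hr, IsScalarTower.algebraMap_apply K (MvPolynomial (Fin n) K)]; rfl⟩

/-- By Gauss's lemma the primitive part of the minimal polynomial, cleared of denominators,
generates the kernel of evaluation. A transcendental y has `minpoly` equal to 0, and then P = 0. -/
theorem Polynomial.exists_aeval_eq_zero_iff_dvd {A F : Type*} [CommRing A] [IsDomain A]
    [UniqueFactorizationMonoid A] [Field F] [Algebra A F] [FaithfulSMul A F] (y : F) :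
    ∃ P : Polynomial A, ∀ Q : Polynomial A, Polynomial.aeval y Q = 0 ↔ P ∣ Q := by
  classical
  let _ : NormalizedGCDMonoid A := Nonempty.some inferInstance
  let _ : Algebra (FractionRing A) F := FractionRing.liftAlgebra A F
  have _ : IsScalarTower A (FractionRing A) F := FractionRing.isScalarTower_liftAlgebra A F
  set μ := minpoly (FractionRing A) y with hμ
  have hev : ∀ Q : Polynomial A, Polynomial.aeval y Q = 0 ↔
      μ ∣ Q.map (algebraMap A (FractionRing A)) := fun Q => by
    rw [hμ, minpoly.dvd_iff, Polynomial.aeval_map_algebraMap]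
  by_cases h0 : μ = 0
  · refine ⟨0, fun Q => ?_⟩
    rw [hev, h0, zero_dvd_iff, zero_dvd_iff, Polynomial.map_eq_zero_iff]
    exact IsFractionRing.injective A (FractionRing A)
  set N := IsLocalization.integerNormalization (nonZeroDivisors A) μ with hN
  obtain ⟨c, hc, hcN⟩ := IsLocalization.integerNormalization_spec (nonZeroDivisors A) μ
  have hc0 : algebraMap A (FractionRing A) c ≠ 0 := by
    simpa using nonZeroDivisors.ne_zero hc
  have hN' : N.map (algebraMap A (FractionRing A)) =
      Polynomial.C (algebraMap A (FractionRing A) c) * μ := by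
    rw [hN, hcN, Algebra.smul_def]; rfl
  have hNne : N ≠ 0 := by
    intro h
    rw [h, Polynomial.map_zero] at hN'
    exact mul_ne_zero (Polynomial.C_ne_zero.2 hc0) h0 hN'.symm
  have hcont : algebraMap A (FractionRing A) N.content ≠ 0 := by
    simpa [Polynomial.content_eq_zero_iff] using hNne
  have hassoc : ∀ S : Polynomial (FractionRing A),
      μ ∣ S ↔ N.primPart.map (algebraMap A (FractionRing A)) ∣ S := by
    intro S
    have h1 : Polynomial.C (algebraMap A (FractionRing A) N.content) *
        N.primPart.map (algebraMap A (FractionRing A)) =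
        Polynomial.C (algebraMap A (FractionRing A) c) * μ := by
      rw [← hN', ← Polynomial.map_C, ← Polynomial.map_mul, ← N.eq_C_content_mul_primPart]
    rw [← IsUnit.mul_left_dvd (Polynomial.isUnit_C.2 hc0.isUnit), ← h1,
      IsUnit.mul_left_dvd (Polynomial.isUnit_C.2 hcont.isUnit)]
  refine ⟨N.primPart, fun Q => ?_⟩
  rw [hev, hassoc, N.isPrimitive_primPart.dvd_iff_fraction_map_dvd_fraction_map (FractionRing A)]

/-- Independence embeds the polynomial ring in the variables other than j into F. This is a
factorial ring, so the one-variable case applies to the variable j over it. -/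
theorem MvPolynomial.exists_aeval_eq_zero_iff_dvd {σ L F : Type*} [Field L] [Field F]
    [Algebra L F] (x : σ → F) (j : σ)
    (hx : AlgebraicIndependent L (fun i : {i // i ≠ j} => x i)) :
    ∃ P : MvPolynomial σ L, ∀ Q : MvPolynomial σ L, aeval x Q = 0 ↔ P ∣ Q := by
  classical
  let _ : Algebra (MvPolynomial {i // i ≠ j} L) F :=
    (aeval (fun i : {i // i ≠ j} => x i) : MvPolynomial {i // i ≠ j} L →ₐ[L] F).toAlgebra
  have _ : FaithfulSMul (MvPolynomial {i // i ≠ j} L) F :=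
    (faithfulSMul_iff_algebraMap_injective _ _).2 hx
  have _ : IsScalarTower L (MvPolynomial {i // i ≠ j} L) F :=
    IsScalarTower.of_algebraMap_eq fun c => (AlgHom.commutes (aeval _) c).symm
  let e : MvPolynomial σ L ≃ₐ[L] Polynomial (MvPolynomial {i // i ≠ j} L) :=
    (renameEquiv L (Equiv.optionSubtypeNe j).symm).trans (optionEquivLeft L _)
  have he : ∀ Q, aeval x Q = Polynomial.aeval (x j) (e Q) := by
    intro Q
    have : (aeval x : MvPolynomial σ L →ₐ[L] F) =
        ((Polynomial.aeval (x j)).restrictScalars L).comp e.toAlgHom := by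
      ext i
      by_cases hi : i = j
      · subst hi; simp [e]
      · have h1 : algebraMap (MvPolynomial {i // i ≠ j} L) F (X ⟨i, hi⟩) = x i := aeval_X _ _
        simp [e, Equiv.optionSubtypeNe_symm_of_ne hi, h1]
    exact DFunLike.congr_fun this Q
  obtain ⟨P, hP⟩ := Polynomial.exists_aeval_eq_zero_iff_dvd
    (A := MvPolynomial {i // i ≠ j} L) (x j)
  refine ⟨e.symm P, fun Q => ?_⟩
  rw [he, hP, ← map_dvd_iff e, e.apply_symm_apply]

theorem RatField.trdeg_eq (n : ℕ) (K : Type*) [Field K] :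
    Algebra.trdeg K (RatField n K) = n := by
  have _ : Algebra.IsAlgebraic (MvPolynomial (Fin n) K) (RatField n K) :=
    IsLocalization.isAlgebraic _ (nonZeroDivisors _)
  rw [← trdeg_add_eq K (MvPolynomial (Fin n) K), (trdeg_eq_zero_iff (R := MvPolynomial (Fin n) K)).2 ‹_›,
    add_zero, MvPolynomial.trdeg_of_isDomain]
  simp

/-- The variables of `K(x)`. -/
noncomputable def RatField.var {n : ℕ} (K : Type*) [Field K] (i : Fin n) : RatField n K :=
  algebraMap (MvPolynomial (Fin n) K) (RatField n K) (X i)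

theorem RatField.aeval_var {n : ℕ} {K : Type*} [Field K] (r : MvPolynomial (Fin n) K) :
    aeval (RatField.var K) r = algebraMap _ (RatField n K) r := by
  have : (aeval (RatField.var K) : MvPolynomial (Fin n) K →ₐ[K] RatField n K) =
      IsScalarTower.toAlgHom K _ _ := by
    ext i; simp [RatField.var]
  exact DFunLike.congr_fun this r

/-- K is algebraically closed in K(x), so L has transcendence degree exactly one and K(x) has
transcendence degree n - 1 over L. A transcendence basis chosen among the variables therefore omits
exactly one of them. -/
theorem RatField.exists_algebraicIndependent_of_trdeg_le_one {n : ℕ} {K : Type*} [Field K]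
    (L : IntermediateField K (RatField n K)) (h1 : Algebra.trdeg K L ≤ 1) (hL : L ≠ ⊥) :
    ∃ j : Fin n, AlgebraicIndependent L (fun i : {i // i ≠ j} => RatField.var K i.1) := by
  classical
  have hne : Algebra.trdeg K L ≠ 0 := by
    intro h0
    rw [trdeg_eq_zero_iff] at h0
    refine hL (eq_bot_iff.2 fun z hz => ?_)
    obtain ⟨c, rfl⟩ := RatField.exists_algebraMap_eq_of_isAlgebraic
      ((isAlgebraic_algebraMap_iff (algebraMap L (RatField n K)).injective).2
        (h0.isAlgebraic (⟨z, hz⟩ : L)))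
    exact IntermediateField.algebraMap_mem _ c
  have h1' : Algebra.trdeg K L = 1 := le_antisymm h1 (Cardinal.one_le_iff_ne_zero.2 hne)
  have hadd := trdeg_add_eq K L (A := RatField n K)
  rw [h1', RatField.trdeg_eq] at hadd
  set v : Fin n → RatField n K := RatField.var K with hv
  have hinj : Function.Injective v := fun i j hij =>
    X_injective (IsFractionRing.injective (MvPolynomial (Fin n) K) (RatField n K) hij)
  have hmem : ∀ r : MvPolynomial (Fin n) K,
      algebraMap _ (RatField n K) r ∈ Algebra.adjoin L (Set.range v) := by
    intro r
    rw [← RatField.aeval_var, ← aeval_map_algebraMap L, Algebra.adjoin_range_eq_range_aeval]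
    exact ⟨_, rfl⟩
  have halg : Algebra.IsAlgebraic (Algebra.adjoin L (Set.range v)) (RatField n K) := by
    refine ⟨fun z => ?_⟩
    obtain ⟨a, b, -, rfl⟩ := IsFractionRing.div_surjective (A := MvPolynomial (Fin n) K) z
    rw [div_eq_mul_inv]
    exact IsAlgebraic.mul (isAlgebraic_algebraMap (⟨_, hmem a⟩ : Algebra.adjoin L (Set.range v)))
      (isAlgebraic_algebraMap (⟨_, hmem b⟩ : Algebra.adjoin L (Set.range v))).inv
  obtain ⟨t, ht, hb⟩ := exists_isTranscendenceBasis_subset (R := L) (Set.range v)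
  rw [← hb.cardinalMk_eq_trdeg] at hadd
  have hfin : t.Finite := (Set.finite_range v).subset ht
  have hcard : t.ncard + 1 = n := by
    rw [← Set.cast_ncard hfin, add_comm] at hadd
    exact_mod_cast hadd
  have hs : (v ⁻¹' t).ncard = t.ncard := Set.ncard_preimage_of_injective_subset_range hinj ht
  obtain ⟨j, hj⟩ : ∃ j, j ∉ v ⁻¹' t := by
    by_contra! h
    rw [Set.eq_univ_of_forall h, Set.ncard_univ, Nat.card_fin] at hs
    omega
  have hcompl : v ⁻¹' t = {j}ᶜ := by
    refine Set.eq_of_subset_of_ncard_le (fun i hi h => hj (h ▸ hi)) ?_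
    have := Set.ncard_add_ncard_compl ({j} : Set (Fin n))
    rw [Set.ncard_singleton, Nat.card_fin] at this
    omega
  have hmem' : ∀ i : {i // i ≠ j}, v i.1 ∈ t := fun i => by
    have : i.1 ∈ v ⁻¹' t := hcompl ▸ i.2
    exact this
  exact ⟨j, hb.1.comp (fun i : {i // i ≠ j} => (⟨v i.1, hmem' i⟩ : t))
    (fun a b hab => Subtype.ext (hinj (Subtype.ext_iff.1 hab)))⟩

/-! ### Linear functionals applied to coefficients -/

section coeffwise

variable {σ E F : Type*} [Field E] [Field F] [Algebra E F]

/-- A linear functional applied to the coefficients of a polynomial. -/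
noncomputable def MvPolynomial.coeffwise (l : F →ₗ[E] E) (R : MvPolynomial σ F) :
    MvPolynomial σ E :=
  ∑ m ∈ R.support, monomial m (l (coeff m R))

theorem MvPolynomial.coeff_coeffwise (l : F →ₗ[E] E) (R : MvPolynomial σ F) (m : σ →₀ ℕ) :
    coeff m (coeffwise l R) = l (coeff m R) := by
  classical
  rw [coeffwise, coeff_sum]
  simp only [coeff_monomial, Finset.sum_ite_eq', mem_support_iff]
  split_ifs with h
  · rfl
  · rw [not_not.1 h, map_zero]

theorem MvPolynomial.coeffwise_add (l : F →ₗ[E] E) (R S : MvPolynomial σ F) :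
    coeffwise l (R + S) = coeffwise l R + coeffwise l S := by
  ext m; simp [coeff_coeffwise]

theorem MvPolynomial.coeffwise_C (l : F →ₗ[E] E) (c : F) :
    coeffwise l (C c : MvPolynomial σ F) = C (l c) := by
  classical
  ext m
  rw [coeff_coeffwise, coeff_C, coeff_C]
  split_ifs <;> simp

theorem MvPolynomial.coeffwise_map_mul (l : F →ₗ[E] E) (U : MvPolynomial σ E)
    (R : MvPolynomial σ F) :
    coeffwise l (map (algebraMap E F) U * R) = U * coeffwise l R := by
  classical
  ext m
  rw [coeff_coeffwise, coeff_mul, coeff_mul, map_sum]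
  refine Finset.sum_congr rfl fun x _ => ?_
  rw [coeff_map, coeff_coeffwise, ← Algebra.smul_def, map_smul, smul_eq_mul]

end coeffwise

/-! ### Exchanging two sets of variables -/

section comm

variable {R S₁ S₂ : Type*} [CommSemiring R]

theorem MvPolynomial.coeff_coeff_commAlgEquiv (P : MvPolynomial S₁ (MvPolynomial S₂ R))
    (m : S₁ →₀ ℕ) (m' : S₂ →₀ ℕ) :
    coeff m (coeff m' (commAlgEquiv R S₁ S₂ P)) = coeff m' (coeff m P) := by
  classical
  induction P using MvPolynomial.induction_on' with
  | add p q hp hq => simp [hp, hq]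
  | monomial k r =>
    rw [coeff_monomial, monomial_eq, map_mul, commAlgEquiv_C]
    have : commAlgEquiv R S₁ S₂ (k.prod fun i e => X i ^ e) = C (monomial k 1) := by
      rw [monomial_eq, C_1, one_mul]; simp only [Finsupp.prod, map_prod, map_pow, commAlgEquiv_X]
    rw [this, mul_comm, coeff_C_mul, coeff_map, mul_comm, coeff_C_mul, coeff_monomial]
    split_ifs <;> simp

theorem MvPolynomial.totalDegree_coeff_le_commAlgEquiv (P : MvPolynomial S₁ (MvPolynomial S₂ R))
    (m : S₁ →₀ ℕ) : (coeff m P).totalDegree ≤ (commAlgEquiv R S₁ S₂ P).totalDegree := by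
  refine Finset.sup_le fun m' hm' => le_totalDegree (s := m') ?_
  rw [mem_support_iff] at hm' ⊢
  intro h
  rw [← coeff_coeff_commAlgEquiv, h, coeff_zero] at hm'
  exact hm' rfl

theorem MvPolynomial.commAlgEquiv_map_C (p : MvPolynomial S₁ R) :
    commAlgEquiv R S₁ S₂ (map C p) = C p := by
  classical
  ext m' m
  rw [coeff_coeff_commAlgEquiv, coeff_map, coeff_C, coeff_C]
  split_ifs <;> simp

end comm

/-! ### The theorem of Gordan and Igusa -/

/-- A form of Gauss's lemma: a prime of R stays prime in the polynomial ring, so the prime factors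
of c can be cancelled one by one from the cofactor of P. -/
theorem MvPolynomial.dvd_of_dvd_C_mul {σ R : Type*} [CommRing R] [IsDomain R]
    [UniqueFactorizationMonoid R] {P : MvPolynomial σ R}
    (hP : ∀ π : R, Prime π → ¬ C π ∣ P) (c : R) (hc : c ≠ 0) (G : MvPolynomial σ R)
    (h : P ∣ C c * G) : P ∣ G := by
  revert hc h
  refine UniqueFactorizationMonoid.induction_on_prime c (by simp) ?_ ?_
  · intro u hu _ h
    exact (IsUnit.dvd_mul_left (hu.map C)).1 h
  · intro r π hr hπ ih _ ⟨A, hA⟩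
    refine ih hr ?_
    have h1 : C π ∣ P * A := ⟨C r * G, by rw [← hA, C_mul, mul_assoc]⟩
    obtain ⟨B, rfl⟩ := (((prime_C_iff (σ := σ)).2 hπ).dvd_or_dvd h1).resolve_left (hP π hπ)
    refine ⟨B, mul_left_cancel₀ ((C_injective σ R).ne_iff' C_0 |>.2 hπ.ne_zero) ?_⟩
    rw [← mul_assoc, ← C_mul, hA]; ring

/-- If f were outside E = K(g), some E-linear functional l would kill f but not 1. Applied to
coefficients, it commutes with the factor a - g b, which is defined over E, and turns the right side
into w u l(1). At the point x the left side vanishes but the right side does not. -/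
theorem RatField.mem_adjoin_of_dvd {n : ℕ} {K : Type*} [Field K] {f g : RatField n K}
    {a b u v w : MvPolynomial (Fin n) K} (hb : b ≠ 0) (hw : w ≠ 0)
    (hg : g = algebraMap _ _ a / algebraMap _ _ b) (hf : f = algebraMap _ _ u / algebraMap _ _ v)
    (hdvd : map (algebraMap K (RatField n K)) a - C g * map (algebraMap K (RatField n K)) b ∣
      map (algebraMap K (RatField n K)) w *
        (map (algebraMap K (RatField n K)) u - C f * map (algebraMap K (RatField n K)) v)) :
    f ∈ IntermediateField.adjoin K {g} := by
  by_contra hfE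
  have hinj := IsFractionRing.injective (MvPolynomial (Fin n) K) (RatField n K)
  set E := IntermediateField.adjoin K {g} with hE
  have h1 : (1 : RatField n K) ∉ Submodule.span E {f} := by
    intro h
    obtain ⟨e, he⟩ := Submodule.mem_span_singleton.1 h
    refine hfE ?_
    rw [show f = ((e⁻¹ : E) : RatField n K) by
      rw [IntermediateField.coe_inv]
      exact eq_inv_of_mul_eq_one_right he]
    exact (e⁻¹).2
  obtain ⟨l, hl1, hlf⟩ := Submodule.exists_le_ker_of_notMem h1
  have hlf' : l f = 0 := hlf (Submodule.mem_span_singleton_self f)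
  obtain ⟨R, hR⟩ := hdvd
  let g' : E := ⟨g, IntermediateField.mem_adjoin_simple_self K g⟩
  have hmap : ∀ r : MvPolynomial (Fin n) K, map (algebraMap K (RatField n K)) r =
      map (algebraMap E (RatField n K)) (map (algebraMap K E) r) := fun r => by
    rw [map_map, ← IsScalarTower.algebraMap_eq]
  have hR' := congrArg (coeffwise l) hR
  rw [show map (algebraMap K (RatField n K)) a - C g * map (algebraMap K (RatField n K)) b =
      map (algebraMap E (RatField n K)) (map (algebraMap K E) a - C g' * map (algebraMap K E) b) by
        rw [map_sub, map_mul, map_C, hmap a, hmap b]; rfl,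
    coeffwise_map_mul,
    show map (algebraMap K (RatField n K)) w *
        (map (algebraMap K (RatField n K)) u - C f * map (algebraMap K (RatField n K)) v) =
      map (algebraMap E (RatField n K)) (map (algebraMap K E) w * map (algebraMap K E) u) * C 1 +
      map (algebraMap E (RatField n K)) (- (map (algebraMap K E) w * map (algebraMap K E) v)) * C f
        by simp only [map_neg, map_mul, ← hmap, C_1]; ring,
    coeffwise_add, coeffwise_map_mul, coeffwise_map_mul, coeffwise_C, coeffwise_C, hlf',
    C_0, mul_zero, add_zero] at hR'
  have hev := congrArg (aeval (RatField.var K)) hR'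
  have hga : algebraMap _ (RatField n K) a - g * algebraMap _ _ b = 0 := by
    rw [hg, div_mul_cancel₀ _ ((map_ne_zero_iff _ hinj).2 hb), sub_self]
  simp only [map_mul, map_sub, aeval_map_algebraMap, aeval_C, RatField.aeval_var] at hev
  rw [show algebraMap E (RatField n K) g' = g from rfl, hga, zero_mul] at hev
  have hu : algebraMap _ (RatField n K) u ≠ 0 := by
    intro hu
    rw [hu, zero_div] at hf
    exact hfE (hf ▸ zero_mem _)
  refine mul_ne_zero (mul_ne_zero ((map_ne_zero_iff _ hinj).2 hw) hu) ?_ hev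
  simpa using hl1

theorem MvPolynomial.exists_map_eq_C_mul {σ R F : Type*} [CommRing R] [IsDomain R] [Field F]
    [Algebra R F] [IsFractionRing R F] (A : MvPolynomial σ F) :
    ∃ r : R, r ≠ 0 ∧ ∃ B : MvPolynomial σ R,
      map (algebraMap R F) B = C (algebraMap R F r) * A := by
  let _ : Algebra (MvPolynomial σ R) (MvPolynomial σ F) := MvPolynomial.algebraMvPolynomial
  obtain ⟨⟨B, s⟩, hB⟩ :=
    IsLocalization.surj ((nonZeroDivisors R).map (C (σ := σ))) A
  obtain ⟨r, hr, hrs⟩ := s.2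
  refine ⟨r, nonZeroDivisors.ne_zero hr, B, ?_⟩
  have h : A * map (algebraMap R F) s.1 = map (algebraMap R F) B := hB
  rw [← h, ← hrs, mul_comm]
  simp

theorem MvPolynomial.totalDegree_map_of_inj {σ R S : Type*} [CommSemiring R] [CommSemiring S]
    {f : R →+* S} (p : MvPolynomial σ R) (hf : Function.Injective f) :
    (map f p).totalDegree = p.totalDegree := by
  rw [totalDegree, totalDegree, support_map_of_injective p hf]

/-- A polynomial with coefficients in an extension field that vanishes at an algebraically
independent point has two coefficients whose ratio is not in the base field. -/
theorem RatField.exists_coeff_div_notMem {n : ℕ} {K : Type*} [Field K]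
    {P : MvPolynomial (Fin n) (RatField n K)} (hP : P ≠ 0) (h0 : eval (RatField.var K) P = 0) :
    ∃ m m₀, coeff m₀ P ≠ 0 ∧
      ∀ c : K, algebraMap K (RatField n K) c ≠ coeff m P / coeff m₀ P := by
  classical
  obtain ⟨m₀, hm₀⟩ := ne_zero_iff.1 hP
  by_contra! hcon
  choose e he using fun m => hcon m m₀ hm₀
  have hP' : P = C (coeff m₀ P) *
      map (algebraMap K (RatField n K)) (∑ m ∈ P.support, monomial m (e m)) := by
    ext m
    rw [coeff_C_mul, coeff_map, coeff_sum]
    simp only [coeff_monomial, Finset.sum_ite_eq', mem_support_iff]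
    split_ifs with h
    · rw [he, mul_div_cancel₀ _ hm₀]
    · rw [not_not.1 h, map_zero, mul_zero]
  rw [hP', map_mul, eval_C, ← aeval_eq_eval, aeval_map_algebraMap,
    RatField.aeval_var] at h0
  have h1 := (map_eq_zero_iff _ (IsFractionRing.injective (MvPolynomial (Fin n) K)
    (RatField n K))).1 ((mul_eq_zero.1 h0).resolve_left hm₀)
  rw [h1, map_zero, mul_zero] at hP'
  exact hP hP'

/-- The theorem of Gordan and Igusa: a subfield of transcendence degree at most one of a
purely transcendental extension is generated by one element. -/
theorem RatField.exists_eq_adjoin_of_trdeg_le_one {n : ℕ} {K : Type*} [Field K]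
    (L : IntermediateField K (RatField n K)) (h1 : Algebra.trdeg K L ≤ 1) :
    ∃ g : RatField n K, L = IntermediateField.adjoin K {g} := by
  classical
  by_cases hL : L = ⊥
  · exact ⟨0, by rw [hL, IntermediateField.adjoin_zero]⟩
  let R := MvPolynomial (Fin n) K
  let F := RatField n K
  have hinj : Function.Injective (algebraMap R F) := IsFractionRing.injective R F
  have hne : ∀ {r : R}, r ≠ 0 → algebraMap R F r ≠ 0 := (map_ne_zero_iff _ hinj).2
  let ρ : MvPolynomial (Fin n) R →+* MvPolynomial (Fin n) F := map (algebraMap R F)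
  have hρ : Function.Injective ρ := map_injective _ hinj
  let κ : R →+* MvPolynomial (Fin n) F := map (algebraMap K F)
  have hρκ : ∀ r : R, ρ (map C r) = κ r := fun r => by
    simp only [ρ, κ, map_map]
    rw [← MvPolynomial.algebraMap_eq, ← IsScalarTower.algebraMap_eq]
  have hκ : ∀ (r : R) m, coeff m (κ r) = algebraMap K F (coeff m r) := fun r m => coeff_map _ _ _
  obtain ⟨j, hj⟩ := RatField.exists_algebraicIndependent_of_trdeg_le_one L h1 hL
  obtain ⟨P, hP⟩ := MvPolynomial.exists_aeval_eq_zero_iff_dvd (L := L) (RatField.var K) j hj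
  set PF : MvPolynomial (Fin n) F := map (algebraMap L F) P with hPF
  -- For f = u/v in L the polynomial u(X) - f v(X) has coefficients in L and vanishes at X = x.
  have hdvd : ∀ u v : R, v ≠ 0 → algebraMap R F u / algebraMap R F v ∈ L →
      PF ∣ κ u - C (algebraMap R F u / algebraMap R F v) * κ v := by
    intro u v hv hf
    have h2 : P ∣ map (algebraMap K L) u -
        C (⟨_, hf⟩ : L) * map (algebraMap K L) v := by
      rw [← hP, map_sub, map_mul, aeval_map_algebraMap, aeval_map_algebraMap, aeval_C,
        RatField.aeval_var, RatField.aeval_var]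
      change algebraMap R F u - algebraMap R F u / algebraMap R F v * algebraMap R F v = 0
      rw [div_mul_cancel₀ _ (hne hv), sub_self]
    have h3 := map_dvd (map (algebraMap L F)) h2
    rw [map_sub, map_mul, map_C, map_map, map_map, ← IsScalarTower.algebraMap_eq] at h3
    exact h3
  -- a nonconstant element of least degree
  have hex : ∃ d : ℕ, ∃ a b : R, b ≠ 0 ∧ algebraMap R F a / algebraMap R F b ∈ L ∧
      (∀ c : K, algebraMap K F c ≠ algebraMap R F a / algebraMap R F b) ∧
      max a.totalDegree b.totalDegree ≤ d := by
    obtain ⟨z, hz, hzK⟩ : ∃ z ∈ L, z ∉ (⊥ : IntermediateField K F) := by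
      by_contra! h
      exact hL (eq_bot_iff.2 h)
    obtain ⟨a, b, hb, rfl⟩ := IsFractionRing.div_surjective (A := R) z
    exact ⟨_, a, b, nonZeroDivisors.ne_zero hb, hz,
      fun c hc => hzK (IntermediateField.mem_bot.2 ⟨c, hc⟩), le_rfl⟩
  obtain ⟨a, b, hb, hgL, hgK, hd⟩ := Nat.find_spec hex
  have hmin := fun d hd => Nat.find_min hex (m := d) hd
  set d := Nat.find hex
  set g : F := algebraMap R F a / algebraMap R F b with hg
  have hG0 : κ a - C g * κ b ≠ 0 := by
    intro h
    obtain ⟨m, hm⟩ := ne_zero_iff.1 hb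
    have h2 := congrArg (coeff m) h
    rw [coeff_sub, coeff_C_mul, hκ, hκ, coeff_zero, sub_eq_zero] at h2
    refine hgK (coeff m a / coeff m b) ?_
    rw [map_div₀, h2, mul_div_cancel_right₀]
    simpa using hm
  have hPF0 : PF ≠ 0 := by
    intro h
    have h2 := hdvd a b hb hgL
    rw [h, zero_dvd_iff] at h2
    exact hG0 h2
  have hPFeval : eval (RatField.var K) PF = 0 := by
    have h2 : aeval (RatField.var K) P = 0 := (hP P).2 dvd_rfl
    rw [hPF, eval_map, ← aeval_def, h2]
  -- a primitive representative of `P`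
  let e := commAlgEquiv K (Fin n) (Fin n)
  -- The total degree of `e Q` is the degree of Q in the variables x of its coefficients. Minimizing
  -- it removes every factor lying in K[x].
  have hex2 : ∃ k : ℕ, ∃ (Q : MvPolynomial (Fin n) R) (c : F), c ≠ 0 ∧ ρ Q = C c * PF ∧
      (e Q).totalDegree = k := by
    obtain ⟨r, hr, B, hB⟩ := MvPolynomial.exists_map_eq_C_mul (R := R) PF
    exact ⟨_, B, _, hne hr, hB, rfl⟩
  obtain ⟨Q, c, hc, hQ, hQk⟩ := Nat.find_spec hex2
  have hmin2 := fun k hk => Nat.find_min hex2 (m := k) hk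
  set k := Nat.find hex2
  have hQ0 : Q ≠ 0 := by
    rintro rfl
    rw [map_zero] at hQ
    exact mul_ne_zero ((map_ne_zero_iff C (C_injective _ _)).2 hc) hPF0 hQ.symm
  have hprim : ∀ π : R, Prime π → ¬ C π ∣ Q := by
    rintro π hπ ⟨S, hS⟩
    have hS0 : S ≠ 0 := by rintro rfl; exact hQ0 (by rw [hS, mul_zero])
    have hdeg : (e Q).totalDegree = π.totalDegree + (e S).totalDegree := by
      rw [hS, map_mul, totalDegree_mul_of_isDomain, commAlgEquiv_C, totalDegree_map_of_inj]
      · exact C_injective _ _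
      · rw [commAlgEquiv_C]
        exact (map_ne_zero_iff _ (map_injective _ (C_injective _ _))).2 hπ.ne_zero
      · exact (map_ne_zero_iff _ e.injective).2 hS0
    have hπd : π.totalDegree ≠ 0 := by
      intro h
      rw [totalDegree_eq_zero_iff_eq_C] at h
      refine hπ.not_isUnit (h ▸ IsUnit.map C (IsUnit.mk0 _ ?_))
      intro h'
      rw [h', C_0] at h
      exact hπ.ne_zero h
    refine hmin2 (e S).totalDegree (by omega)
      ⟨S, (algebraMap R F π)⁻¹ * c, mul_ne_zero (inv_ne_zero (hne hπ.ne_zero)) hc, ?_, rfl⟩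
    rw [C_mul, mul_assoc, ← hQ, hS, map_mul]
    simp only [ρ, map_C]
    rw [← mul_assoc, ← C_mul, inv_mul_cancel₀ (hne hπ.ne_zero), C_1, one_mul]
  -- divide
  set G : MvPolynomial (Fin n) R := C b * map C a - C a * map C b with hG
  have hρG : ρ G = C (algebraMap R F b) * (κ a - C g * κ b) := by
    rw [hG, map_sub, map_mul, map_mul, hρκ, hρκ, mul_sub, ← mul_assoc, ← C_mul, hg,
      mul_div_cancel₀ _ (hne hb)]
    simp [ρ]
  have hCb : C (σ := Fin n) (algebraMap R F b) ≠ 0 :=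
    (map_ne_zero_iff C (C_injective _ _)).2 (hne hb)
  have hQG : Q ∣ G := by
    obtain ⟨A, hA⟩ := hdvd a b hb hgL
    obtain ⟨r, hr, B, hB⟩ := MvPolynomial.exists_map_eq_C_mul (R := R)
      (C (algebraMap R F b) * C c⁻¹ * A)
    refine MvPolynomial.dvd_of_dvd_C_mul hprim r hr G ⟨B, hρ ?_⟩
    have hcc : C (σ := Fin n) c * C c⁻¹ = 1 := by rw [← C_mul, mul_inv_cancel₀ hc, C_1]
    rw [map_mul, map_mul, hρG, hQ, hA]
    change _ = _ * map (algebraMap R F) B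
    rw [hB]
    simp only [ρ, map_C]
    linear_combination (-(C (algebraMap R F r) * C (algebraMap R F b) * PF * A)) * hcc
  obtain ⟨W, hW⟩ := hQG
  have hGne : G ≠ 0 := by
    intro h
    rw [h, map_zero] at hρG
    exact mul_ne_zero hCb hG0 hρG.symm
  have hW0 : W ≠ 0 := by rintro rfl; exact hGne (by rw [hW, mul_zero])
  have hGd : (e G).totalDegree ≤ d := by
    rw [hG, map_sub, map_mul, map_mul]
    rw [commAlgEquiv_C, commAlgEquiv_C, commAlgEquiv_map_C, commAlgEquiv_map_C]
    refine (totalDegree_sub _ _).trans (max_le ?_ ?_) <;>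
    refine (totalDegree_mul _ _).trans ?_ <;>
    rw [totalDegree_C, add_zero, totalDegree_map_of_inj _ (C_injective _ _)]
    · exact (le_max_right _ _).trans hd
    · exact (le_max_left _ _).trans hd
  -- Some ratio of coefficients of Q is nonconstant and lies in L, since Q is proportional to P. If
  -- Q had degree below d in x, this ratio would contradict the choice of g.
  have hQd : d ≤ (e Q).totalDegree := by
    by_contra! hlt
    obtain ⟨m, m₀, hm₀, hm⟩ := RatField.exists_coeff_div_notMem hPF0 hPFeval
    have hco : ∀ m, algebraMap R F (coeff m Q) = c * coeff m PF := fun m => by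
      rw [← coeff_C_mul, ← hQ, coeff_map]
    have hrat : algebraMap R F (coeff m Q) / algebraMap R F (coeff m₀ Q) =
        coeff m PF / coeff m₀ PF := by
      rw [hco, hco, mul_div_mul_left _ _ hc]
    refine hmin _ hlt ⟨coeff m Q, coeff m₀ Q, ?_, ?_, ?_, ?_⟩
    · intro h
      have h2 := hco m₀
      rw [h, map_zero] at h2
      exact mul_ne_zero hc hm₀ h2.symm
    · rw [hrat, hPF, coeff_map, coeff_map]
      exact div_mem (coeff m P).2 (coeff m₀ P).2
    · rw [hrat]; exact hm
    · exact max_le (totalDegree_coeff_le_commAlgEquiv _ _)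
        (totalDegree_coeff_le_commAlgEquiv _ _)
  -- G has degree at most d in x and Q at least d, so W is free of x.
  have hWd : (e W).totalDegree = 0 := by
    rw [hW, map_mul, totalDegree_mul_of_isDomain ((map_ne_zero_iff _ e.injective).2 hQ0)
      ((map_ne_zero_iff _ e.injective).2 hW0)] at hGd
    omega
  rw [totalDegree_eq_zero_iff_eq_C] at hWd
  set w := coeff 0 (e W)
  have hWw : W = map C w := e.injective (by rw [hWd]; exact (commAlgEquiv_map_C w).symm)
  have hw0 : w ≠ 0 := by rintro h; rw [h, map_zero] at hWw; exact hW0 hWw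
  refine ⟨g, le_antisymm (fun f hf => ?_) (IntermediateField.adjoin_simple_le_iff.2 hgL)⟩
  obtain ⟨u, v, hv, rfl⟩ := IsFractionRing.div_surjective (A := R) f
  refine RatField.mem_adjoin_of_dvd hb hw0 hg rfl ?_
  obtain ⟨A, hA⟩ := hdvd u v (nonZeroDivisors.ne_zero hv) hf
  change κ a - C g * κ b ∣ κ w * (κ u - C (algebraMap R F u / algebraMap R F v) * κ v)
  -- Up to nonzero scalars of K(x), a - g b equals w times P, and P divides u - f v.
  rw [hA, ← IsUnit.mul_left_dvd (IsUnit.map C (hne hb).isUnit), ← hρG, hW, map_mul, hQ, hWw, hρκ,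
    mul_assoc, IsUnit.mul_left_dvd (IsUnit.map C hc.isUnit)]
  exact ⟨A, by ring⟩

/-! ### The transcendence degree of K(tH) -/

theorem IntermediateField.trdeg_adjoin_simple_of_transcendental {L M : Type u} [Field L] [Field M]
    [Algebra L M] {a : M} (ha : Transcendental L a) :
    Algebra.trdeg L (IntermediateField.adjoin L {a}) = 1 := by
  rw [← (RatFunc.algEquivOfTranscendental a ha).trdeg_eq]
  have _ : Algebra.IsAlgebraic (Polynomial L) (RatFunc L) :=
    IsLocalization.isAlgebraic _ (nonZeroDivisors _)
  rw [← trdeg_add_eq L (Polynomial L), (trdeg_eq_zero_iff (R := Polynomial L)).2 ‹_›, add_zero,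
    Polynomial.trdeg_of_isDomain]

theorem RatFunc.transcendental_X_mul_C {F : Type*} [Field F] {c : F} (hc : c ≠ 0) :
    Transcendental F (RatFunc.X * RatFunc.C c : RatFunc F) := by
  refine RatFunc.transcendental_of_ne_C _ ?_
  rintro ⟨d, hd⟩
  have hc' : RatFunc.C c ≠ 0 := (map_ne_zero_iff _ RatFunc.C_injective).2 hc
  have hX : (RatFunc.X : RatFunc F) = RatFunc.C (d / c) := by
    rw [map_div₀, ← hd, mul_div_cancel_right₀ _ hc']
  have := congrArg RatFunc.num hX
  rw [RatFunc.num_X, RatFunc.num_C] at this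
  exact Polynomial.X_ne_C _ this

/-- The field generated over `K` by the ratios of the components of `H` to the `i₀`-th one. -/
noncomputable def ratioField (K : Type*) {F ι : Type*} [Field K] [Field F] [Algebra K F]
    (H : ι → F) (i₀ : ι) : IntermediateField K F :=
  IntermediateField.adjoin K (Set.range fun i => H i / H i₀)

theorem div_mem_ratioField (K : Type*) {F ι : Type*} [Field K] [Field F] [Algebra K F]
    (H : ι → F) (i i₀ : ι) : H i / H i₀ ∈ ratioField K H i₀ :=
  IntermediateField.subset_adjoin _ _ ⟨i, rfl⟩

theorem trdegT_eq_add_one (K : Type*) {F ι : Type*} [Field K] [Field F] [Algebra K F]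
    (H : ι → F) {i₀ : ι} (h0 : H i₀ ≠ 0) :
    trdegT K H = Algebra.trdeg K (ratioField K H i₀) + 1 := by
  set L := ratioField K H i₀ with hL
  set E := IntermediateField.adjoin K
    (Set.range fun i => (RatFunc.X * RatFunc.C (H i) : RatFunc F)) with hE
  set a : RatFunc F := RatFunc.X * RatFunc.C (H i₀) with ha
  have hC0 : RatFunc.C (H i₀) ≠ 0 := (map_ne_zero_iff _ RatFunc.C_injective).2 h0
  have haE : ∀ i, (RatFunc.X * RatFunc.C (H i) : RatFunc F) ∈ E := fun i =>
    IntermediateField.subset_adjoin _ _ ⟨i, rfl⟩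
  have hLE : ∀ x : L, algebraMap L (RatFunc F) x ∈ E := by
    have h1 : L ≤ E.comap (IsScalarTower.toAlgHom K F (RatFunc F)) := by
      rw [hL, ratioField, IntermediateField.adjoin_le_iff]
      rintro _ ⟨i, rfl⟩
      change RatFunc.C (H i / H i₀) ∈ E
      rw [map_div₀, ← mul_div_mul_left _ _ RatFunc.X_ne_zero]
      exact div_mem (haE i) (haE i₀)
    exact fun x => h1 x.2
  set E' := IntermediateField.adjoin L {a} with hE'
  -- Each generator t `H i` is the ratio `H i / H i₀` times t `H i₀`; conversely, t cancels in the
  -- quotient of two generators.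
  have hEE' : E = E'.restrictScalars K := by
    refine le_antisymm ?_ ?_
    · rw [hE, IntermediateField.adjoin_le_iff]
      rintro _ ⟨i, rfl⟩
      change (RatFunc.X * RatFunc.C (H i) : RatFunc F) ∈ E'
      rw [show (RatFunc.X * RatFunc.C (H i) : RatFunc F) =
          algebraMap L (RatFunc F) ⟨_, div_mem_ratioField K H i i₀⟩ * a by
        change _ = RatFunc.C (H i / H i₀) * a
        rw [map_div₀, ha]
        field_simp]
      exact mul_mem (IntermediateField.algebraMap_mem _ _)
        (IntermediateField.mem_adjoin_simple_self _ _)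
    · have h2 : E' ≤ E.toSubfield.toIntermediateField hLE :=
        IntermediateField.adjoin_simple_le_iff.2 (haE i₀)
      exact fun x hx => h2 hx
  have htr : Transcendental L a :=
    Transcendental.restrictScalars (FaithfulSMul.algebraMap_injective L F)
      (RatFunc.transcendental_X_mul_C h0)
  have h3 := IntermediateField.trdeg_adjoin_simple_of_transcendental htr
  have _ : FaithfulSMul L E' :=
    (faithfulSMul_iff_algebraMap_injective _ _).2 (algebraMap L E').injective
  have h4 := trdeg_add_eq K L (A := E')
  rw [h3] at h4
  rw [trdegT, ← hE, hEE', h4]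
  rfl

theorem trdegT_eq_zero (K : Type*) {F ι : Type*} [Field K] [Field F] [Algebra K F] :
    trdegT K (0 : ι → F) = 0 := by
  rw [trdegT, trdeg_eq_zero_iff]
  have : IntermediateField.adjoin K
      (Set.range fun i => (RatFunc.X * RatFunc.C ((0 : ι → F) i) : RatFunc F)) = ⊥ := by
    rw [IntermediateField.adjoin_eq_bot_iff]
    rintro _ ⟨i, rfl⟩
    simp [zero_mem]
  rw [this]
  infer_instance

theorem ratioField_mul_left (K : Type*) {F ι : Type*} [Field K] [Field F] [Algebra K F]
    (H : ι → F) (i₀ : ι) {c : F} (hc : c ≠ 0) :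
    ratioField K (fun i => c * H i) i₀ = ratioField K H i₀ := by
  simp only [ratioField, mul_div_mul_left _ _ hc]

theorem trdegT_mul_left (K : Type*) {F ι : Type*} [Field K] [Field F] [Algebra K F]
    (H : ι → F) {c : F} (hc : c ≠ 0) : trdegT K (fun i => c * H i) = trdegT K H := by
  by_cases h : H = 0
  · subst h; simp only [Pi.zero_apply, mul_zero]; rfl
  · obtain ⟨i₀, h0⟩ := Function.ne_iff.1 h
    rw [trdegT_eq_add_one K H h0, trdegT_eq_add_one K (fun i => c * H i) (mul_ne_zero hc h0),
      ratioField_mul_left K H i₀ hc]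

/-- An embedding carries the field of ratios isomorphically onto that of the image tuple. This lets
tuples over different fields be compared. -/
theorem trdegT_algHom_comp {K : Type*} {ι : Type*} {F F' : Type u} [Field K] [Field F] [Field F']
    [Algebra K F] [Algebra K F'] (φ : F →ₐ[K] F') (H : ι → F) :
    trdegT K (fun i => φ (H i)) = trdegT K H := by
  by_cases h : H = 0
  · subst h
    simp only [Pi.zero_apply, map_zero]
    rw [show (fun _ : ι => (0 : F')) = 0 from rfl, trdegT_eq_zero, trdegT_eq_zero]
  · obtain ⟨i₀, h0⟩ := Function.ne_iff.1 h
    have h0' : φ (H i₀) ≠ 0 := (map_ne_zero_iff _ φ.injective).2 h0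
    rw [trdegT_eq_add_one K H h0, trdegT_eq_add_one K (fun i => φ (H i)) h0']
    have : ratioField K (fun i => φ (H i)) i₀ = (ratioField K H i₀).map φ := by
      rw [ratioField, ratioField, IntermediateField.adjoin_map, ← Set.range_comp]
      congr 2
      ext i
      simp
    rw [this, ((ratioField K H i₀).equivMap φ).trdeg_eq]

/-- The field of ratios is algebraic over K, and K is algebraically closed in K(x). -/
theorem div_mem_of_trdegT_le_one {K ι : Type*} {n : ℕ} [Field K] {H : ι → RatField n K}
    {i₀ : ι} (h0 : H i₀ ≠ 0) (h : trdegT K H ≤ 1) (i : ι) :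
    ∃ c : K, H i = algebraMap K (RatField n K) c * H i₀ := by
  rw [trdegT_eq_add_one K H h0] at h
  have h1 : Algebra.trdeg K (ratioField K H i₀) = 0 := by
    have h' : Algebra.trdeg K (ratioField K H i₀) + 1 ≤ 0 + 1 := by rwa [zero_add]
    rw [Cardinal.add_one_le_add_one_iff] at h'
    simpa using h'
  rw [trdeg_eq_zero_iff] at h1
  obtain ⟨c, hc⟩ := RatField.exists_algebraMap_eq_of_isAlgebraic
    ((isAlgebraic_algebraMap_iff (algebraMap (ratioField K H i₀) (RatField n K)).injective).2
      (h1.isAlgebraic ⟨_, div_mem_ratioField K H i i₀⟩))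
  exact ⟨c, by rw [hc]; exact (div_mul_cancel₀ _ h0).symm⟩

theorem trdegT_algebraMap_le_one {K F ι : Type*} [Field K] [Field F] [Algebra K F] (c : ι → K) :
    trdegT K (fun i => algebraMap K F (c i)) ≤ 1 := by
  by_cases h : c = 0
  · subst h
    simp only [Pi.zero_apply, map_zero]
    rw [show (fun _ : ι => (0 : F)) = 0 from rfl, trdegT_eq_zero]
    exact zero_le_one
  · obtain ⟨i₀, h0⟩ := Function.ne_iff.1 h
    rw [trdegT_eq_add_one K _ (i₀ := i₀) ((map_ne_zero_iff _ (algebraMap K F).injective).2 h0)]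
    have : ratioField K (fun i => algebraMap K F (c i)) i₀ = ⊥ := by
      rw [ratioField, IntermediateField.adjoin_eq_bot_iff]
      rintro _ ⟨i, rfl⟩
      exact ⟨c i / c i₀, by simp⟩
    rw [this, trdeg_eq_zero_iff.2 inferInstance, zero_add]

/-! ### Primitive nonconstant pairs -/

theorem isPrimitiveTuple_pair {R : Type*} [CommRing R] {p q : R} :
    IsPrimitiveTuple ![p, q] ↔ ∀ d, d ∣ p → d ∣ q → IsUnit d := by
  simp [IsPrimitiveTuple, Fin.forall_fin_two]

theorem isConstTuple_pair {K σ : Type*} [Field K] {p q : MvPolynomial σ K} :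
    IsConstTuple ![p, q] ↔ (∃ c, p = C c) ∧ ∃ c, q = C c := by
  constructor
  · rintro ⟨c, hc⟩
    exact ⟨⟨c 0, hc 0⟩, ⟨c 1, hc 1⟩⟩
  · rintro ⟨⟨a, rfl⟩, ⟨b, rfl⟩⟩
    exact ⟨![a, b], by simp [Fin.forall_fin_two]⟩

theorem IsPrimitiveTuple.ne_zero {R ι : Type*} [CommRing R] [Nontrivial R] {H : ι → R}
    (h : IsPrimitiveTuple H) : H ≠ 0 := by
  rintro rfl
  exact not_isUnit_zero (h 0 fun i => dvd_rfl)

section pair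

variable {K σ : Type*} [Field K] {p q : MvPolynomial σ K}

/-- Linear independence of p and q over K: in a nontrivial relation one of them would be a scalar
multiple of the other, which would then be a common divisor, hence a unit, and both would be
constant. -/
theorem eq_zero_of_C_mul_eq_C_mul (hpq : IsPrimitiveTuple ![p, q])
    (hc : ¬ IsConstTuple ![p, q]) {a b : K} (h : C a * p = C b * q) : a = 0 ∧ b = 0 := by
  rw [isPrimitiveTuple_pair] at hpq
  rw [isConstTuple_pair] at hc
  have hC : ∀ {r : MvPolynomial σ K}, IsUnit r → ∃ c, r = C c := fun hr => by
    obtain ⟨c, -, hc⟩ := isUnit_iff_eq_C_of_isReduced.1 hr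
    exact ⟨c, hc⟩
  have key : ∀ {r s : MvPolynomial σ K} {a b : K}, (∀ d, d ∣ r → d ∣ s → IsUnit d) →
      C a * r = C b * s → a ≠ 0 → (∃ c, r = C c) ∧ ∃ c, s = C c := by
    intro r s a b hrs h ha
    have hr : r = C (a⁻¹ * b) * s := by
      rw [C_mul, mul_assoc, ← h, ← mul_assoc, ← C_mul, inv_mul_cancel₀ ha, C_1, one_mul]
    obtain ⟨c, rfl⟩ := hC (hrs s (hr ▸ dvd_mul_left _ _) dvd_rfl)
    exact ⟨⟨_, by rw [hr, ← C_mul]⟩, ⟨c, rfl⟩⟩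
  constructor
  · by_contra ha
    exact hc (key hpq h ha)
  · by_contra hb
    exact hc (key (fun d h1 h2 => hpq d h2 h1) h.symm hb).symm

theorem snd_ne_zero_of_pair (hpq : IsPrimitiveTuple ![p, q]) (hc : ¬ IsConstTuple ![p, q]) :
    q ≠ 0 := by
  rintro rfl
  exact one_ne_zero (eq_zero_of_C_mul_eq_C_mul hpq hc (a := 0) (b := 1) (by simp)).2

end pair

theorem transcendental_div_of_pair {K : Type*} [Field K] {n : ℕ} {p q : MvPolynomial (Fin n) K}
    (hpq : IsPrimitiveTuple ![p, q]) (hc : ¬ IsConstTuple ![p, q]) :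
    Transcendental K (algebraMap _ (RatField n K) p / algebraMap _ (RatField n K) q) := by
  intro h
  have hinj := IsFractionRing.injective (MvPolynomial (Fin n) K) (RatField n K)
  have hq := (map_ne_zero_iff _ hinj).2 (snd_ne_zero_of_pair hpq hc)
  obtain ⟨c, hcz⟩ := RatField.exists_algebraMap_eq_of_isAlgebraic h
  rw [eq_div_iff hq, IsScalarTower.algebraMap_apply K (MvPolynomial (Fin n) K), ← map_mul] at hcz
  have := eq_zero_of_C_mul_eq_C_mul hpq hc (a := 1) (b := c)
    (by rw [C_1, one_mul]; exact (hinj hcz).symm)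
  exact one_ne_zero this.1

/-! ### Primitive homogeneous tuples in two variables -/

theorem MvPolynomial.IsHomogeneous.aeval_mul_left {K A σ : Type*} [CommRing K] [CommRing A]
    [Algebra K A] {h : MvPolynomial σ K} {s : ℕ} (hh : h.IsHomogeneous s) (y : A) (v : σ → A) :
    MvPolynomial.aeval (fun i => y * v i) h = y ^ s * MvPolynomial.aeval v h := by
  rw [h.as_sum, map_sum, map_sum, Finset.mul_sum]
  refine Finset.sum_congr rfl fun m hm => ?_
  rw [aeval_monomial, aeval_monomial]
  have hs : m.degree = s := by
    by_contra hne
    exact mem_support_iff.1 hm (hh.coeff_eq_zero hne)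
  simp only [Finsupp.prod, mul_pow, Finset.prod_mul_distrib, Finset.prod_pow_eq_pow_sum]
  rw [← hs, Finsupp.degree_apply]
  ring

theorem MvPolynomial.IsHomogeneous.aeval_pair {K F : Type*} [Field K] [Field F] [Algebra K F]
    {h : MvPolynomial (Fin 2) K} {s : ℕ} (hh : h.IsHomogeneous s) (x : F) {y : F} (hy : y ≠ 0) :
    MvPolynomial.aeval ![x, y] h =
      y ^ s * Polynomial.aeval (x / y) (MvPolynomial.aeval ![(Polynomial.X : Polynomial K), 1] h) := by
  have h1 : Polynomial.aeval (x / y) (MvPolynomial.aeval ![(Polynomial.X : Polynomial K), 1] h) =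
      MvPolynomial.aeval ![x / y, 1] h := by
    have : (Polynomial.aeval (R := K) (x / y)).comp
        (MvPolynomial.aeval ![(Polynomial.X : Polynomial K), 1]) =
        MvPolynomial.aeval ![x / y, 1] := by
      ext i; fin_cases i <;> simp
    exact DFunLike.congr_fun this h
  rw [h1, ← hh.aeval_mul_left]
  congr 2
  ext i; fin_cases i
  · simp [mul_div_cancel₀ _ hy]
  · simp

theorem MvPolynomial.IsHomogeneous.natDegree_aeval_X_one_le {K : Type*} [Field K]
    {h : MvPolynomial (Fin 2) K} {s : ℕ} (hh : h.IsHomogeneous s) :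
    (MvPolynomial.aeval ![(Polynomial.X : Polynomial K), 1] h : Polynomial K).natDegree ≤ s := by
  rw [h.as_sum, map_sum]
  refine Polynomial.natDegree_sum_le_of_forall_le _ _ fun m hm => ?_
  have hs : m.degree = s := by
    by_contra hne
    exact mem_support_iff.1 hm (hh.coeff_eq_zero hne)
  rw [aeval_monomial, Finsupp.prod_fintype _ _ (by simp), Fin.prod_univ_two]
  simp only [Matrix.cons_val_zero, Matrix.cons_val_one, one_pow, mul_one]
  refine (Polynomial.natDegree_C_mul_X_pow_le _ _).trans ?_
  rw [← hs]
  exact Finsupp.le_degree _ _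

/-- The second variable lies in the radical of the ideal generated by a primitive homogeneous
tuple in two variables. -/
theorem exists_X_one_pow_mem_span {K ι : Type*} [Field K] {h : ι → MvPolynomial (Fin 2) K}
    (hh : IsHomogTuple h) (hp : IsPrimitiveTuple h) :
    ∃ N : ℕ, (X 1 : MvPolynomial (Fin 2) K) ^ N ∈ Ideal.span (Set.range h) := by
  obtain ⟨s, hs⟩ := hh
  set a : ι → Polynomial K := fun i => aeval ![(Polynomial.X : Polynomial K), 1] (h i) with ha
  have hah : ∀ i, (a i).homogenize s = h i := fun i =>
    Polynomial.homogenize_eq_of_isHomogeneous (hs i) rfl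
  -- A generator d of the ideal of dehomogenized components homogenizes to a common divisor of h,
  -- hence to a unit; setting the second variable to 1 shows that d is a unit.
  have htop : Ideal.span (Set.range a) = ⊤ := by
    obtain ⟨d, hd⟩ := (IsPrincipalIdealRing.principal (Ideal.span (Set.range a))).principal
    have hda : ∀ i, d ∣ a i := fun i => by
      rw [← Ideal.mem_span_singleton]
      change a i ∈ Submodule.span _ _
      rw [← hd]
      exact Ideal.subset_span ⟨i, rfl⟩
    have hu : IsUnit (d.homogenize d.natDegree) := by
      refine hp _ fun i => ?_
      rw [← hah]
      by_cases h0 : a i = 0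
      · rw [h0, Polynomial.homogenize_zero]; exact dvd_zero _
      · obtain ⟨e, he⟩ := hda i
        have hd0 : d ≠ 0 := by rintro rfl; exact h0 (by rw [he, zero_mul])
        have he0 : e ≠ 0 := by rintro rfl; exact h0 (by rw [he, mul_zero])
        have hdeg : d.natDegree + e.natDegree ≤ s := by
          rw [← Polynomial.natDegree_mul hd0 he0, ← he]
          exact (hs i).natDegree_aeval_X_one_le
        rw [he, show s = d.natDegree + (s - d.natDegree) by omega,
          Polynomial.homogenize_mul _ _ le_rfl (by omega)]
        exact dvd_mul_right _ _
    have hu' := hu.map (aeval (R := K) ![(Polynomial.X : Polynomial K), 1])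
    rw [Polynomial.aeval_homogenize_X_one _ le_rfl] at hu'
    rw [hd]
    exact Ideal.span_singleton_eq_top.2 hu'
  -- Membership survives homogenization in every large degree; for f = 1 the homogenization is a
  -- power of `X 1`.
  have key : ∀ f ∈ Ideal.span (Set.range a), ∃ N₀, ∀ N, N₀ ≤ N →
      f.homogenize N ∈ Ideal.span (Set.range h) := by
    intro f hf
    induction hf using Submodule.span_induction with
    | mem f hf =>
      obtain ⟨i, rfl⟩ := hf
      refine ⟨s, fun N hN => ?_⟩
      rw [show N = s + (N - s) by omega, ← mul_one (a i),
        Polynomial.homogenize_mul _ _ (hs i).natDegree_aeval_X_one_le (by simp), hah]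
      exact Ideal.mul_mem_right _ _ (Ideal.subset_span ⟨i, rfl⟩)
    | zero => exact ⟨0, fun N _ => by simp⟩
    | add f g _ _ hf hg =>
      obtain ⟨M, hM⟩ := hf
      obtain ⟨N, hN⟩ := hg
      refine ⟨max M N, fun k hk => ?_⟩
      rw [Polynomial.homogenize_add]
      exact add_mem (hM k (le_of_max_le_left hk)) (hN k (le_of_max_le_right hk))
    | smul r f _ hf =>
      obtain ⟨M, hM⟩ := hf
      refine ⟨M + r.natDegree + f.natDegree, fun k hk => ?_⟩
      rw [show k = r.natDegree + (k - r.natDegree) by omega, smul_eq_mul,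
        Polynomial.homogenize_mul _ _ le_rfl (by omega)]
      exact Ideal.mul_mem_left _ _ (hM _ (by omega))
  obtain ⟨N, hN⟩ := key 1 (by rw [htop]; trivial)
  exact ⟨N, by simpa using hN N le_rfl⟩

/-- Stated for an arbitrary ideal so as to serve twice: a principal ideal yields primitivity of
h(p,q), and the zero ideal yields the absence of nontrivial common zeros. The claim for x follows
from that for y by swapping the variables. -/
theorem exists_pow_mem_of_aeval_mem {K ι A : Type*} [Field K] [CommRing A] [Algebra K A]
    {h : ι → MvPolynomial (Fin 2) K} (hh : IsHomogTuple h) (hp : IsPrimitiveTuple h)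
    {x y : A} {I : Ideal A} (hI : ∀ i, aeval ![x, y] (h i) ∈ I) :
    (∃ N : ℕ, x ^ N ∈ I) ∧ ∃ N : ℕ, y ^ N ∈ I := by
  have key : ∀ {h : ι → MvPolynomial (Fin 2) K} {x y : A}, IsHomogTuple h → IsPrimitiveTuple h →
      (∀ i, aeval ![x, y] (h i) ∈ I) → ∃ N : ℕ, y ^ N ∈ I := by
    intro h x y hh hp hI
    obtain ⟨N, hN⟩ := exists_X_one_pow_mem_span hh hp
    refine ⟨N, ?_⟩
    have hle : Ideal.span (Set.range h) ≤
        I.comap (aeval ![x, y] : MvPolynomial (Fin 2) K →ₐ[K] A) := by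
      rw [Ideal.span_le]
      rintro _ ⟨i, rfl⟩
      exact hI i
    simpa using hle hN
  refine ⟨?_, key hh hp hI⟩
  obtain ⟨s, hs⟩ := hh
  let e := renameEquiv K (Equiv.swap (0 : Fin 2) 1)
  refine key (h := fun i => e (h i)) (x := y) ⟨s, fun i => (hs i).rename_isHomogeneous⟩ ?_ ?_
  · intro d hd
    have : IsUnit (e.symm d) := hp _ fun i => by
      rw [← map_dvd_iff e, e.apply_symm_apply]; exact hd i
    simpa using this
  · intro i
    have : aeval ![y, x] (e (h i)) = aeval ![x, y] (h i) := by
      simp only [e, renameEquiv_apply, aeval_rename]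
      congr 2
      ext j; fin_cases j <;> simp
    rw [this]
    exact hI i

theorem IsPrimitiveTuple.substPair {K ι σ : Type*} [Field K] {h : ι → MvPolynomial (Fin 2) K}
    {p q : MvPolynomial σ K} (hh : IsHomogTuple h) (hp : IsPrimitiveTuple h)
    (hpq : IsPrimitiveTuple ![p, q]) : IsPrimitiveTuple (substPair h p q) := by
  intro d hd
  obtain ⟨⟨N, hN⟩, ⟨M, hM⟩⟩ := exists_pow_mem_of_aeval_mem (I := Ideal.span {d}) hh hp
    fun i => Ideal.mem_span_singleton.2 (hd i)
  rw [Ideal.mem_span_singleton] at hN hM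
  have hrel : IsRelPrime p q := fun d h1 h2 => isPrimitiveTuple_pair.1 hpq d h1 h2
  -- A common divisor of h(p,q) divides a power of p and a power of q, which are coprime.
  exact (hrel.pow (m := N) (n := M)) hN hM

/-! ### The transcendence degree for h(p,q) -/

theorem algebraMap_aeval_pair {K : Type*} [Field K] {n : ℕ} (p q : MvPolynomial (Fin n) K)
    (h : MvPolynomial (Fin 2) K) : algebraMap _ (RatField n K) (aeval ![p, q] h) =
      aeval ![algebraMap _ (RatField n K) p, algebraMap _ (RatField n K) q] h := by
  have : (IsScalarTower.toAlgHom K (MvPolynomial (Fin n) K) (RatField n K)).comp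
      (MvPolynomial.aeval (R := K) ![p, q]) =
      aeval ![algebraMap _ (RatField n K) p, algebraMap _ (RatField n K) q] := by
    ext j; fin_cases j <;> simp
  exact DFunLike.congr_fun this h

/-- After the common factor q^s is dropped, h(p,q) becomes h(T,1) at T = p/q, and T ↦ p/q embeds
K(T) into K(x). The right side does not involve (p,q), so the pair of variables of K[y] can be
compared with any other pair. -/
theorem trdegT_substPair_eq_trdegT_ratFunc {K ι : Type*} [Field K] {n : ℕ}
    {h : ι → MvPolynomial (Fin 2) K} {s : ℕ} (hs : ∀ i, (h i).IsHomogeneous s)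
    {p q : MvPolynomial (Fin n) K} (hpq : IsPrimitiveTuple ![p, q])
    (hc : ¬ IsConstTuple ![p, q]) :
    trdegT K (fun i => algebraMap _ (RatField n K) (substPair h p q i)) =
      trdegT K (fun i => algebraMap (Polynomial K) (RatFunc K)
        (aeval ![(Polynomial.X : Polynomial K), 1] (h i))) := by
  have hinj := IsFractionRing.injective (MvPolynomial (Fin n) K) (RatField n K)
  have hq := (map_ne_zero_iff _ hinj).2 (snd_ne_zero_of_pair hpq hc)
  have ht := transcendental_div_of_pair hpq hc
  set θ := algebraMap _ (RatField n K) p / algebraMap _ (RatField n K) q with hθ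
  have hθ' := transcendental_iff_injective.1 ht
  let φ : RatFunc K →ₐ[K] RatField n K := RatFunc.liftAlgHom (Polynomial.aeval θ)
    (nonZeroDivisors_le_comap_nonZeroDivisors_of_injective _ hθ')
  have h1 : ∀ a : Polynomial K, φ (algebraMap (Polynomial K) (RatFunc K) a) =
      Polynomial.aeval θ a := fun a => by
    have := RatFunc.liftAlgHom_apply_div (Polynomial.aeval θ)
      (nonZeroDivisors_le_comap_nonZeroDivisors_of_injective _ hθ') a 1
    simpa using this
  have h2 : ∀ i, algebraMap _ (RatField n K) (substPair h p q i) =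
      algebraMap _ (RatField n K) q ^ s * φ (algebraMap (Polynomial K) (RatFunc K)
        (aeval ![Polynomial.X, 1] (h i))) := fun i => by
    rw [h1, hθ, ← (hs i).aeval_pair _ hq, substPair, algebraMap_aeval_pair]
  rw [funext h2, trdegT_mul_left K _ (pow_ne_zero s hq), trdegT_algHom_comp φ]

theorem trdegT_substPair {K : Type*} [Field K] {m n : ℕ}
    {h : Fin m → MvPolynomial (Fin 2) K} (hh : IsHomogTuple h)
    {p q : MvPolynomial (Fin n) K} (hpq : IsPrimitiveTuple ![p, q])
    (hc : ¬ IsConstTuple ![p, q]) :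
    trdegT K (fun i => algebraMap _ (RatField n K) (substPair h p q i)) =
      trdegT K (fun i => algebraMap (MvPolynomial (Fin 2) K) (RatField 2 K) (h i)) := by
  obtain ⟨s, hs⟩ := hh
  have h1 : substPair h (X 0) (X 1) = h := by
    ext1 i
    rw [substPair, show (![X 0, X 1] : Fin 2 → MvPolynomial (Fin 2) K) = X by
      ext1 j; fin_cases j <;> rfl, aeval_X_left, AlgHom.id_apply]
  rw [trdegT_substPair_eq_trdegT_ratFunc hs hpq hc, ← trdegT_substPair_eq_trdegT_ratFunc (n := 2) hs
    (p := X 0) (q := X 1), h1]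
  · rw [isPrimitiveTuple_pair]
    intro d h0 h1
    obtain ⟨e, he⟩ := h0
    rcases (X_prime (i := (0 : Fin 2)) (R := K)).irreducible.isUnit_or_isUnit he with hd | hu
    · exact hd
    · have h01 : (X 0 : MvPolynomial (Fin 2) K) ∣ X 1 := by
        rw [he, IsUnit.mul_right_dvd hu]; exact h1
      rw [X_dvd_X] at h01
      simp at h01
  · rw [isConstTuple_pair]
    rintro ⟨⟨c, hc⟩, -⟩
    have := congrArg totalDegree hc
    simp at this

/-! ### Degrees through homogeneous components -/

section tupleDeg

variable {K σ ι : Type*} [Field K] {F : ι → MvPolynomial σ K}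

theorem homogeneousComponent_degree_ne_zero {f : MvPolynomial σ K} {m : σ →₀ ℕ}
    (hm : m ∈ f.support) : homogeneousComponent m.degree f ≠ 0 := by
  intro h
  have := congrArg (coeff m) h
  rw [coeff_homogeneousComponent, if_pos rfl, coeff_zero] at this
  exact mem_support_iff.1 hm this

theorem exists_mem_support_of_homogeneousComponent_ne_zero {f : MvPolynomial σ K} {d : ℕ}
    (h : homogeneousComponent d f ≠ 0) : ∃ m ∈ f.support, m.degree = d := by
  classical
  obtain ⟨m, hm⟩ := ne_zero_iff.1 h
  rw [coeff_homogeneousComponent] at hm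
  split_ifs at hm with hd
  · exact ⟨m, mem_support_iff.2 hm, hd⟩
  · exact absurd rfl hm

theorem tupleDeg_eq [Fintype ι] {D : ℕ} (h1 : ∀ i k, D < k → homogeneousComponent k (F i) = 0)
    (h2 : ∃ i, homogeneousComponent D (F i) ≠ 0) : tupleDeg F = D := by
  refine le_antisymm (Finset.sup_le fun i _ => Finset.sup_le fun m hm => ?_) ?_
  · by_contra! hlt
    exact homogeneousComponent_degree_ne_zero hm (h1 i _ (by exact_mod_cast hlt))
  · obtain ⟨i, hi⟩ := h2
    obtain ⟨m, hm, rfl⟩ := exists_mem_support_of_homogeneousComponent_ne_zero hi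
    exact (Finset.le_sup (f := fun m : σ →₀ ℕ => ((m.degree : ℕ) : WithBot ℕ)) hm).trans
      (Finset.le_sup (f := fun i => (F i).support.sup fun d => ((d.degree : ℕ) : WithBot ℕ))
        (Finset.mem_univ i))

theorem tupleLowDeg_eq [Fintype ι] {D : ℕ} (h1 : ∀ i k, k < D → homogeneousComponent k (F i) = 0)
    (h2 : ∃ i, homogeneousComponent D (F i) ≠ 0) : tupleLowDeg F = D := by
  refine le_antisymm ?_ (Finset.le_inf fun i _ => Finset.le_inf fun m hm => ?_)
  · obtain ⟨i, hi⟩ := h2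
    obtain ⟨m, hm, rfl⟩ := exists_mem_support_of_homogeneousComponent_ne_zero hi
    exact (Finset.inf_le (f := fun i => (F i).support.inf fun d => ((d.degree : ℕ) : ℕ∞))
        (Finset.mem_univ i)).trans
      (Finset.inf_le (f := fun m : σ →₀ ℕ => ((m.degree : ℕ) : ℕ∞)) hm)
  · by_contra! hlt
    exact homogeneousComponent_degree_ne_zero hm (h1 i _ (by exact_mod_cast hlt))

theorem exists_homogeneousComponent_ne_zero (hF : F ≠ 0) :
    ∃ k i, homogeneousComponent k (F i) ≠ 0 := by
  obtain ⟨i, hi⟩ := Function.ne_iff.1 hF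
  obtain ⟨m, hm⟩ := support_nonempty.2 hi
  exact ⟨_, i, homogeneousComponent_degree_ne_zero hm⟩

theorem exists_top_component [Fintype ι] (hF : F ≠ 0) :
    ∃ D : ℕ, (∀ i k, D < k → homogeneousComponent k (F i) = 0) ∧
      ∃ i, homogeneousComponent D (F i) ≠ 0 := by
  set S := {k | ∃ i, homogeneousComponent k (F i) ≠ 0}
  have hbdd : BddAbove S := by
    refine ⟨Finset.univ.sup fun i => (F i).totalDegree, ?_⟩
    rintro k ⟨i, hi⟩
    obtain ⟨m, hm, rfl⟩ := exists_mem_support_of_homogeneousComponent_ne_zero hi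
    exact (le_totalDegree hm).trans
      (Finset.le_sup (f := fun i => (F i).totalDegree) (Finset.mem_univ i))
  refine ⟨sSup S, fun i k hk => ?_, Nat.sSup_mem (exists_homogeneousComponent_ne_zero hF) hbdd⟩
  by_contra h
  exact absurd (le_csSup hbdd ⟨i, h⟩) (not_le.2 hk)

theorem exists_low_component (hF : F ≠ 0) :
    ∃ D : ℕ, (∀ i k, k < D → homogeneousComponent k (F i) = 0) ∧
      ∃ i, homogeneousComponent D (F i) ≠ 0 := by
  classical
  have hex := exists_homogeneousComponent_ne_zero hF
  refine ⟨Nat.find hex, fun i k hk => ?_, Nat.find_spec hex⟩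
  by_contra h
  exact Nat.find_min hex hk ⟨i, h⟩

theorem isHomogTuple_iff_tupleDeg_eq_tupleLowDeg [Fintype ι] {D d : ℕ} (hF : F ≠ 0) (hD : tupleDeg F = D)
    (hd : tupleLowDeg F = d) : IsHomogTuple F ↔ D = d := by
  classical
  constructor
  · rintro ⟨s, hs⟩
    have hcomp : ∀ i k, k ≠ s → homogeneousComponent k (F i) = 0 := fun i k hk => by
      rw [homogeneousComponent_of_mem (hs i), if_neg hk]
    have hne : ∃ i, homogeneousComponent s (F i) ≠ 0 := by
      obtain ⟨k, i, hk⟩ := exists_homogeneousComponent_ne_zero hF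
      by_cases hks : k = s
      · exact ⟨i, hks ▸ hk⟩
      · exact absurd (hcomp i k hks) hk
    have h1 := tupleDeg_eq (fun i k hk => hcomp i k hk.ne') hne
    have h2 := tupleLowDeg_eq (fun i k hk => hcomp i k hk.ne) hne
    rw [hD] at h1
    rw [hd] at h2
    have h1' : D = s := by exact_mod_cast h1
    have h2' : d = s := by exact_mod_cast h2
    rw [h1', h2']
  · rintro rfl
    refine ⟨D, fun i m hm => ?_⟩
    have hms : m ∈ (F i).support := mem_support_iff.2 hm
    have h1 : ((m.degree : ℕ) : WithBot ℕ) ≤ D := hD ▸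
      (Finset.le_sup (f := fun m : σ →₀ ℕ => ((m.degree : ℕ) : WithBot ℕ)) hms).trans
      (Finset.le_sup (f := fun i => (F i).support.sup fun d => ((d.degree : ℕ) : WithBot ℕ))
        (Finset.mem_univ i))
    have h2 : (D : ℕ∞) ≤ ((m.degree : ℕ) : ℕ∞) := hd ▸
      (Finset.inf_le (f := fun i => (F i).support.inf fun d => ((d.degree : ℕ) : ℕ∞))
        (Finset.mem_univ i)).trans
      (Finset.inf_le (f := fun m : σ →₀ ℕ => ((m.degree : ℕ) : ℕ∞)) hms)
    have h3 : m.degree = D := le_antisymm (by exact_mod_cast h1) (by exact_mod_cast h2)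
    rw [← h3, Finsupp.degree_eq_weight_one]
    rfl

end tupleDeg

/-! ### The grading homomorphism and the degrees of h(p,q) -/

section grade

variable {K σ : Type*} [Field K]

/-- The homomorphism `x ↦ xT`, which separates the homogeneous components. -/
noncomputable def gradeHom (K σ : Type*) [Field K] :
    MvPolynomial σ K →ₐ[K] Polynomial (MvPolynomial σ K) :=
  aeval fun i => Polynomial.X * Polynomial.C (X i)

theorem coeff_gradeHom (f : MvPolynomial σ K) (k : ℕ) :
    (gradeHom K σ f).coeff k = homogeneousComponent k f := by
  classical
  induction f using MvPolynomial.induction_on' with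
  | add p q hp hq => simp [hp, hq]
  | monomial m c =>
    have h1 : gradeHom K σ (monomial m c) =
        Polynomial.X ^ m.degree * Polynomial.C (monomial m c) := by
      rw [gradeHom, (isHomogeneous_monomial c rfl : (monomial m c).IsHomogeneous _).aeval_mul_left]
      congr 1
      have : (aeval fun i => Polynomial.C (X i)) =
          (Algebra.ofId (MvPolynomial σ K) (Polynomial (MvPolynomial σ K))).restrictScalars K := by
        ext i; simp [Algebra.ofId_apply]
      rw [this]; rfl
    rw [h1, Polynomial.coeff_X_pow_mul', homogeneousComponent_of_mem (isHomogeneous_monomial c rfl),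
      Polynomial.coeff_C]
    split_ifs <;> first | rfl | omega

theorem natDegree_gradeHom_le {f : MvPolynomial σ K} {D : ℕ}
    (h : ∀ k, D < k → homogeneousComponent k f = 0) : (gradeHom K σ f).natDegree ≤ D :=
  Polynomial.natDegree_le_iff_coeff_eq_zero.2 fun k hk => by rw [coeff_gradeHom, h k hk]

/-- Every monomial of h has degree s, so only the coefficients of P and Q in degree D contribute in
degree sD. -/
theorem aeval_pair_natDegree_le {A : Type*} [CommRing A] [Algebra K A]
    {h : MvPolynomial (Fin 2) K} {s D : ℕ} (hh : h.IsHomogeneous s) {P Q : Polynomial A}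
    (hP : P.natDegree ≤ D) (hQ : Q.natDegree ≤ D) :
    (aeval ![P, Q] h).natDegree ≤ s * D ∧
      (aeval ![P, Q] h).coeff (s * D) = aeval ![P.coeff D, Q.coeff D] h := by
  have key : ∀ m ∈ h.support, (P ^ m 0 * Q ^ m 1).natDegree ≤ s * D ∧
      (P ^ m 0 * Q ^ m 1).coeff (s * D) = P.coeff D ^ m 0 * Q.coeff D ^ m 1 := by
    intro m hm
    have hs : m 0 + m 1 = s := by
      by_contra hne
      refine mem_support_iff.1 hm (hh.coeff_eq_zero ?_)
      rwa [Finsupp.degree_eq_sum, Fin.sum_univ_two]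
    have h1 := Polynomial.natDegree_pow_le_of_le (m 0) hP
    have h2 := Polynomial.natDegree_pow_le_of_le (m 1) hQ
    rw [← hs, add_mul]
    exact ⟨Polynomial.natDegree_mul_le_of_le h1 h2, by
      rw [Polynomial.coeff_mul_add_eq_of_natDegree_le h1 h2, Polynomial.coeff_pow_of_natDegree_le hP,
        Polynomial.coeff_pow_of_natDegree_le hQ]⟩
  have hsum : ∀ {B : Type _} [CommRing B] [Algebra K B] (x y : B), aeval ![x, y] h =
      ∑ m ∈ h.support, coeff m h • (x ^ m 0 * y ^ m 1) := by
    intro B _ _ x y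
    conv_lhs => rw [h.as_sum, map_sum]
    refine Finset.sum_congr rfl fun m _ => ?_
    rw [aeval_monomial, Finsupp.prod_fintype _ _ (by simp), Fin.prod_univ_two, Algebra.smul_def]
    rfl
  rw [hsum P Q, hsum]
  constructor
  · exact Polynomial.natDegree_sum_le_of_forall_le _ _ fun m hm =>
      (Polynomial.natDegree_smul_le _ _).trans (key m hm).1
  · rw [Polynomial.finsetSum_coeff]
    exact Finset.sum_congr rfl fun m hm => by rw [Polynomial.coeff_smul, (key m hm).2]

theorem gradeHom_aeval_pair (p q : MvPolynomial σ K) (h : MvPolynomial (Fin 2) K) :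
    gradeHom K σ (aeval ![p, q] h) = aeval ![gradeHom K σ p, gradeHom K σ q] h := by
  have : (gradeHom K σ).comp (aeval ![p, q]) = aeval ![gradeHom K σ p, gradeHom K σ q] := by
    ext1 j; fin_cases j <;> simp
  exact DFunLike.congr_fun this h

theorem exists_aeval_pair_ne_zero {ι A : Type*} [CommRing A] [IsDomain A] [Algebra K A]
    {h : ι → MvPolynomial (Fin 2) K} (hh : IsHomogTuple h) (hp : IsPrimitiveTuple h)
    {x y : A} (hxy : x ≠ 0 ∨ y ≠ 0) : ∃ i, aeval ![x, y] (h i) ≠ 0 := by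
  by_contra! hcon
  obtain ⟨⟨N, hN⟩, ⟨M, hM⟩⟩ := exists_pow_mem_of_aeval_mem (I := ⊥) hh hp hcon
  exact hxy.elim (fun hx => pow_ne_zero N hx hN) fun hy => pow_ne_zero M hy hM

/-- The extreme homogeneous components of `h(p, q)`. -/
theorem exists_tupleDeg_substPair {ι : Type*} [Fintype ι] {h : ι → MvPolynomial (Fin 2) K} {s : ℕ}
    (hs : ∀ i, (h i).IsHomogeneous s) (hp : IsPrimitiveTuple h) {p q : MvPolynomial σ K}
    (hpq : (![p, q] : Fin 2 → MvPolynomial σ K) ≠ 0) :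
    ∃ D d : ℕ, tupleDeg ![p, q] = D ∧ tupleLowDeg ![p, q] = d ∧
      tupleDeg (substPair h p q) = (s * D : ℕ) ∧ tupleLowDeg (substPair h p q) = (s * d : ℕ) := by
  obtain ⟨D, hD1, hD2⟩ := exists_top_component hpq
  obtain ⟨d, hd1, hd2⟩ := exists_low_component hpq
  refine ⟨D, d, tupleDeg_eq hD1 hD2, tupleLowDeg_eq hd1 hd2, ?_, ?_⟩
  · have hnp := natDegree_gradeHom_le (f := p) (hD1 0)
    have hnq := natDegree_gradeHom_le (f := q) (hD1 1)
    have key := fun i => aeval_pair_natDegree_le (hs i) hnp hnq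
    refine tupleDeg_eq (fun i k hk => ?_) ?_
    · rw [substPair, ← coeff_gradeHom, gradeHom_aeval_pair]
      exact Polynomial.coeff_eq_zero_of_natDegree_lt ((key i).1.trans_lt hk)
    -- The component of h(p,q) in degree sD is h evaluated at the components of p and q in degree D,
    -- which are not both zero.
    · obtain ⟨i, hi⟩ := exists_aeval_pair_ne_zero ⟨s, hs⟩ hp
        (x := homogeneousComponent D p) (y := homogeneousComponent D q)
        (by simpa [Fin.exists_fin_two] using hD2)
      refine ⟨i, ?_⟩
      rwa [substPair, ← coeff_gradeHom, gradeHom_aeval_pair, (key i).2, coeff_gradeHom,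
        coeff_gradeHom]
  -- At the low end, T^d is split off from the images of p and q; homogeneity of h then splits off
  -- T^(sd), and T = 0 in the cofactor gives the lowest component.
  · have hX : ∀ f : MvPolynomial σ K, (∀ k, k < d → homogeneousComponent k f = 0) →
        ∃ g, gradeHom K σ f = Polynomial.X ^ d * g := fun f hf =>
      Polynomial.X_pow_dvd_iff.2 fun k hk => by rw [coeff_gradeHom, hf k hk]
    obtain ⟨p', hp'⟩ := hX p (hd1 0)
    obtain ⟨q', hq'⟩ := hX q (hd1 1)
    have hcoef : ∀ f : MvPolynomial σ K, ∀ f' : Polynomial (MvPolynomial σ K),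
        gradeHom K σ f = Polynomial.X ^ d * f' → f'.coeff 0 = homogeneousComponent d f := by
      intro f f' hf
      rw [← coeff_gradeHom, hf, Polynomial.coeff_X_pow_mul', if_pos le_rfl, Nat.sub_self]
    have key : ∀ i, gradeHom K σ (substPair h p q i) =
        Polynomial.X ^ (s * d) * aeval ![p', q'] (h i) := by
      intro i
      rw [substPair, gradeHom_aeval_pair, mul_comm s d, pow_mul, ← (hs i).aeval_mul_left, hp', hq']
      congr 2
      ext1 j; fin_cases j <;> rfl
    refine tupleLowDeg_eq (fun i k hk => ?_) ?_
    · rw [← coeff_gradeHom, key, Polynomial.coeff_X_pow_mul', if_neg (not_le.2 hk)]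
    · obtain ⟨i, hi⟩ := exists_aeval_pair_ne_zero ⟨s, hs⟩ hp
        (x := homogeneousComponent d p) (y := homogeneousComponent d q)
        (by simpa [Fin.exists_fin_two] using hd2)
      refine ⟨i, ?_⟩
      rw [← coeff_gradeHom, key, Polynomial.coeff_X_pow_mul', if_pos le_rfl, Nat.sub_self]
      have h0 : (aeval ![p', q'] (h i)).coeff 0 =
          aeval ![homogeneousComponent d p, homogeneousComponent d q] (h i) := by
        rw [← hcoef p p' hp', ← hcoef q q' hq']
        have : ((Polynomial.constantCoeff : Polynomial (MvPolynomial σ K) →+* _).comp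
            (aeval (R := K) ![p', q']).toRingHom) =
            (aeval (R := K) ![p'.coeff 0, q'.coeff 0]).toRingHom := by
          ext j
          · simp
          · fin_cases j <;> simp
        exact DFunLike.congr_fun this (h i)
      rwa [h0]

end grade

/-! ### Factors of homogeneous polynomials -/

section homogFactor

variable {K σ : Type*} [Field K]

theorem gradeHom_eq_of_isHomogeneous {f : MvPolynomial σ K} {s : ℕ} (hf : f.IsHomogeneous s) :
    gradeHom K σ f = Polynomial.X ^ s * Polynomial.C f := by
  ext1 k
  rw [coeff_gradeHom, homogeneousComponent_of_mem hf, Polynomial.coeff_X_pow_mul',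
    Polynomial.coeff_C]
  split_ifs <;> first | rfl | omega

theorem gradeHom_ne_zero {f : MvPolynomial σ K} (hf : f ≠ 0) : gradeHom K σ f ≠ 0 := by
  intro h
  obtain ⟨m, hm⟩ := support_nonempty.2 hf
  refine homogeneousComponent_degree_ne_zero hm ?_
  rw [← coeff_gradeHom, h, Polynomial.coeff_zero]

/-- Under x ↦ xT the product becomes a monomial in T, whose degree and trailing degree coincide.
Both are additive over a domain, so they coincide for each factor. -/
theorem exists_isHomogeneous_of_mul {f g : MvPolynomial σ K} {s : ℕ}
    (h : (f * g).IsHomogeneous s) (hf : f ≠ 0) (hg : g ≠ 0) :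
    ∃ a, f.IsHomogeneous a := by
  have h1 := gradeHom_eq_of_isHomogeneous h
  have hf' := gradeHom_ne_zero hf
  have hg' := gradeHom_ne_zero hg
  have hC : (Polynomial.C (f * g)) ≠ 0 := Polynomial.C_ne_zero.2 (mul_ne_zero hf hg)
  have hX : (Polynomial.X : Polynomial (MvPolynomial σ K)) ^ s ≠ 0 :=
    pow_ne_zero _ Polynomial.X_ne_zero
  rw [map_mul] at h1
  have hd := congrArg Polynomial.natDegree h1
  have ht := congrArg Polynomial.natTrailingDegree h1
  rw [Polynomial.natDegree_mul hf' hg', Polynomial.natDegree_mul hX hC, Polynomial.natDegree_X_pow,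
    Polynomial.natDegree_C] at hd
  rw [Polynomial.natTrailingDegree_mul hf' hg', Polynomial.natTrailingDegree_mul hX hC,
    Polynomial.natTrailingDegree_X_pow, Polynomial.natTrailingDegree_C] at ht
  have hle1 := Polynomial.natTrailingDegree_le_natDegree (gradeHom K σ f)
  have hle2 := Polynomial.natTrailingDegree_le_natDegree (gradeHom K σ g)
  refine ⟨(gradeHom K σ f).natDegree, fun m hm => ?_⟩
  have hne := homogeneousComponent_degree_ne_zero (mem_support_iff.2 hm)
  rw [← coeff_gradeHom] at hne
  have h2 := Polynomial.le_natDegree_of_ne_zero hne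
  have h3 := Polynomial.natTrailingDegree_le_of_ne_zero hne
  have h4 : m.degree = (gradeHom K σ f).natDegree := by omega
  rw [← h4, Finsupp.degree_eq_weight_one]
  rfl

theorem isHomogeneous_of_mul_of_isHomogeneous {f g : MvPolynomial σ K} {a s : ℕ}
    (hf : f.IsHomogeneous a) (hf0 : f ≠ 0) (h : (f * g).IsHomogeneous s) :
    g.IsHomogeneous (s - a) := by
  by_cases hg : g = 0
  · rw [hg]; exact isHomogeneous_zero _ _ _
  obtain ⟨b, hb⟩ := exists_isHomogeneous_of_mul (mul_comm f g ▸ h) hg hf0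
  have := (hf.mul hb).inj_right h (mul_ne_zero hf0 hg)
  rwa [show s - a = b by omega]

theorem exists_eq_mul_isPrimitiveTuple {ι : Type*} [Finite ι] {f : ι → MvPolynomial σ K}
    (hf : IsHomogTuple f) (h0 : f ≠ 0) :
    ∃ (d : MvPolynomial σ K) (h : ι → MvPolynomial σ K), d ≠ 0 ∧ (∀ i, f i = d * h i) ∧
      IsHomogTuple h ∧ IsPrimitiveTuple h := by
  classical
  have _ := Fintype.ofFinite ι
  let _ : NormalizedGCDMonoid (MvPolynomial σ K) := Nonempty.some inferInstance
  obtain ⟨s, hs⟩ := hf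
  obtain ⟨i₀, hi₀⟩ := Function.ne_iff.1 h0
  obtain ⟨h, hh, hgcd⟩ := Finset.extract_gcd (s := Finset.univ) f ⟨i₀, Finset.mem_univ _⟩
  set d := Finset.univ.gcd f
  have hh' : ∀ i, f i = d * h i := fun i => hh i (Finset.mem_univ i)
  have hne : d * h i₀ ≠ 0 := by rw [← hh']; exact hi₀
  have hd0 := left_ne_zero_of_mul hne
  have hhom : (d * h i₀).IsHomogeneous s := hh' i₀ ▸ hs i₀
  obtain ⟨a, ha⟩ := exists_isHomogeneous_of_mul hhom hd0 (right_ne_zero_of_mul hne)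
  refine ⟨d, h, hd0, hh', ⟨s - a, fun i =>
    isHomogeneous_of_mul_of_isHomogeneous ha hd0 (hh' i ▸ hs i)⟩, fun e he => ?_⟩
  exact isUnit_of_dvd_one (hgcd ▸ Finset.dvd_gcd fun i _ => he i)

end homogFactor

/-! ### Existence of the representation -/

theorem exists_isPairForm_of_div_mem {K : Type*} [Field K] {n m : ℕ} {H : Fin m → RatField n K}
    {i₀ : Fin m} (h0 : H i₀ ≠ 0) {p q : MvPolynomial (Fin n) K}
    (hpq : IsPrimitiveTuple ![p, q]) (hc : ¬ IsConstTuple ![p, q])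
    (hH : ∀ i, H i / H i₀ ∈ IntermediateField.adjoin K
      {algebraMap _ (RatField n K) p / algebraMap _ (RatField n K) q}) :
    ∃ g h, IsPairForm H g h p q := by
  classical
  have hinj := IsFractionRing.injective (MvPolynomial (Fin n) K) (RatField n K)
  have hq := (map_ne_zero_iff _ hinj).2 (snd_ne_zero_of_pair hpq hc)
  have ht := transcendental_div_of_pair hpq hc
  set θ := algebraMap _ (RatField n K) p / algebraMap _ (RatField n K) q with hθ
  have hθ0 : ∀ {a : Polynomial K}, a ≠ 0 → Polynomial.aeval θ a ≠ 0 :=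
    (map_ne_zero_iff _ (transcendental_iff_injective.1 ht)).2
  have hrs : ∀ i, ∃ r s : Polynomial K, s ≠ 0 ∧
      H i / H i₀ = Polynomial.aeval θ r / Polynomial.aeval θ s := by
    intro i
    obtain ⟨r, s, h⟩ := (IntermediateField.mem_adjoin_simple_iff K _).1 (hH i)
    by_cases hs : s = 0
    -- A zero denominator gives the value 0 by convention, which 0/1 represents as well.
    · exact ⟨0, 1, one_ne_zero, by rw [h, hs]; simp⟩
    · exact ⟨r, s, hs, h⟩
  choose r s hs0 hrs using hrs
  set B := ∏ i, s i with hB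
  have hB0 : B ≠ 0 := Finset.prod_ne_zero_iff.2 fun i _ => hs0 i
  choose c hcB using fun i => Finset.dvd_prod_of_mem s (Finset.mem_univ i)
  set b : Fin m → Polynomial K := fun i => r i * c i
  have hb : ∀ i, H i = H i₀ / Polynomial.aeval θ B * Polynomial.aeval θ (b i) := by
    intro i
    have h1 := hθ0 (hs0 i)
    have h2 : Polynomial.aeval θ (c i) ≠ 0 :=
      hθ0 (right_ne_zero_of_mul ((hcB i).symm.trans_ne hB0))
    rw [hB, hcB i, map_mul, map_mul, ← div_mul_cancel₀ (H i) h0, hrs]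
    field_simp
  -- Homogenizing all numerators in one common degree S makes q^S a common factor: f(p,q) = q^S
  -- b(p/q).
  set S := Finset.univ.sup fun i => (b i).natDegree
  have hbS : ∀ i, (b i).natDegree ≤ S := fun i =>
    Finset.le_sup (f := fun i => (b i).natDegree) (Finset.mem_univ i)
  set f : Fin m → MvPolynomial (Fin 2) K := fun i => (b i).homogenize S
  have hf0 : f ≠ 0 := by
    intro h
    have h1 : b i₀ = 0 := Polynomial.eq_zero_of_homogenize_eq_zero (hbS i₀) (congrFun h i₀)
    refine h0 ?_
    rw [hb, h1, map_zero, mul_zero]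
  obtain ⟨d, h, hd0, hfd, hhom, hprim⟩ := exists_eq_mul_isPrimitiveTuple (f := f)
    ⟨S, fun i => Polynomial.isHomogeneous_homogenize _⟩ hf0
  have hfi : ∀ i, H i = H i₀ / Polynomial.aeval θ B / algebraMap _ (RatField n K) q ^ S *
      algebraMap _ (RatField n K) (aeval ![p, q] (f i)) := by
    intro i
    have hS : algebraMap _ (RatField n K) q ^ S ≠ 0 := pow_ne_zero _ hq
    rw [algebraMap_aeval_pair, (Polynomial.isHomogeneous_homogenize (b i)).aeval_pair _ hq,
      Polynomial.aeval_homogenize_X_one _ (hbS i), hb i, ← mul_assoc, div_mul_cancel₀ _ hS]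
  have hgi : ∀ i, H i = (H i₀ / Polynomial.aeval θ B / algebraMap _ (RatField n K) q ^ S *
      algebraMap _ (RatField n K) (aeval ![p, q] d)) *
      algebraMap _ (RatField n K) (substPair h p q i) := by
    intro i
    rw [hfi i, hfd i, map_mul, map_mul, ← mul_assoc]; rfl
  refine ⟨_, h, hgi, ?_, .inl ⟨hhom, hprim⟩, hpq, hc⟩
  intro hg
  refine h0 ?_
  rw [hgi i₀, hg, zero_mul]

theorem exists_pair_mem_adjoin {K : Type*} [Field K] {n : ℕ} (hn : 1 ≤ n) (z : RatField n K) :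
    ∃ p q : MvPolynomial (Fin n) K, IsPrimitiveTuple ![p, q] ∧ ¬ IsConstTuple ![p, q] ∧
      z ∈ IntermediateField.adjoin K
        {algebraMap _ (RatField n K) p / algebraMap _ (RatField n K) q} := by
  obtain ⟨p, q, hpq, hz⟩ := IsFractionRing.exists_reduced_fraction (A := MvPolynomial (Fin n) K) z
  have hz' : algebraMap _ (RatField n K) p / algebraMap _ (RatField n K) q.1 = z := by
    rw [← hz, IsFractionRing.mk'_eq_div]
  by_cases hc : IsConstTuple ![p, q.1]
  -- A constant z lies in every such field, so any coprime nonconstant pair will do; here n ≥ 1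
  -- supplies a variable.
  · refine ⟨X ⟨0, hn⟩, 1, ?_, ?_, ?_⟩
    · rw [isPrimitiveTuple_pair]
      exact fun d _ h => isUnit_of_dvd_one h
    · rw [isConstTuple_pair]
      rintro ⟨⟨c, hc⟩, -⟩
      have := congrArg totalDegree hc
      simp at this
    · obtain ⟨⟨a, ha⟩, ⟨b, hb⟩⟩ := isConstTuple_pair.1 hc
      rw [← hz', ha, hb]
      exact div_mem (IntermediateField.algebraMap_mem _ a) (IntermediateField.algebraMap_mem _ b)
  · exact ⟨p, q.1, isPrimitiveTuple_pair.2 fun d h1 h2 => hpq h1 h2, hc,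
      hz' ▸ IntermediateField.mem_adjoin_simple_self K _⟩

theorem exists_isPairForm {K : Type*} [Field K] {n m : ℕ} (hn : 1 ≤ n)
    (H : Fin m → RatField n K) (hH : trdegT K H ≤ 2) :
    ∃ g h p q, IsPairForm H g h p q := by
  by_cases h0 : H = 0
  · obtain ⟨p, q, hpq, hc, -⟩ := exists_pair_mem_adjoin hn (0 : RatField n K)
    exact ⟨1, 0, p, q, fun i => by simp [h0, substPair], one_ne_zero, .inr rfl, hpq, hc⟩
  · obtain ⟨i₀, hi₀⟩ := Function.ne_iff.1 h0
    rw [trdegT_eq_add_one K H hi₀, ← one_add_one_eq_two, Cardinal.add_one_le_add_one_iff] at hH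
    obtain ⟨z, hz⟩ := RatField.exists_eq_adjoin_of_trdeg_le_one _ hH
    obtain ⟨p, q, hpq, hc, hzp⟩ := exists_pair_mem_adjoin hn z
    obtain ⟨g, h, hf⟩ := exists_isPairForm_of_div_mem hi₀ hpq hc fun i =>
      IntermediateField.adjoin_simple_le_iff.2 hzp (hz ▸ div_mem_ratioField K H i i₀)
    exact ⟨g, h, p, q, hf⟩

/-! ### Properties of a given representation -/

section IsPairForm

variable {K : Type*} [Field K] {n m : ℕ} {H : Fin m → RatField n K} {g : RatField n K}
  {h : Fin m → MvPolynomial (Fin 2) K} {p q : MvPolynomial (Fin n) K}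

theorem IsPairForm.homog_primitive (hf : IsPairForm H g h p q) (h0 : h ≠ 0) :
    IsHomogTuple h ∧ IsPrimitiveTuple h :=
  hf.homog_or_zero.resolve_right h0

theorem IsPairForm.isHomogTuple (hf : IsPairForm H g h p q) : IsHomogTuple h := by
  rcases hf.homog_or_zero with h1 | rfl
  · exact h1.1
  · exact ⟨0, fun i => isHomogeneous_zero _ _ _⟩

theorem IsPairForm.primitive_substPair (hf : IsPairForm H g h p q) (h0 : h ≠ 0) :
    IsPrimitiveTuple (substPair h p q) :=
  (hf.homog_primitive h0).2.substPair (hf.homog_primitive h0).1 hf.pair_primitive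

theorem IsPairForm.eq_zero (hf : IsPairForm H g h p q) (h0 : substPair h p q = 0) : H = 0 := by
  ext1 i
  rw [hf.eq i, h0, Pi.zero_apply, map_zero, mul_zero, Pi.zero_apply]

theorem IsPairForm.tfae_primitive (hf : IsPairForm H g h p q) :
    List.TFAE [H ≠ 0, IsPrimitiveTuple (substPair h p q), IsPrimitiveTuple h, h ≠ 0] := by
  tfae_have 1 → 4 := by
    rintro hH rfl
    exact hH (hf.eq_zero (by ext1 i; simp [substPair]))
  tfae_have 4 → 3 := fun h0 => (hf.homog_primitive h0).2
  tfae_have 3 → 2 := fun hp => hf.primitive_substPair hp.ne_zero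
  tfae_have 2 → 1 := by
    rintro hp rfl
    refine hp.ne_zero ?_
    ext1 i
    have := hf.eq i
    rw [Pi.zero_apply, eq_comm, mul_eq_zero, or_iff_right hf.g_ne_zero,
      map_eq_zero_iff _ (IsFractionRing.injective _ _)] at this
    exact this
  tfae_finish

theorem IsPairForm.trdegT_eq (hf : IsPairForm H g h p q) :
    trdegT K H = trdegT K (fun i => algebraMap (MvPolynomial (Fin n) K) (RatField n K)
      (substPair h p q i)) := by
  rw [funext hf.eq, trdegT_mul_left K _ hf.g_ne_zero]

theorem IsPairForm.trdegT_eq' (hf : IsPairForm H g h p q) :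
    trdegT K H = trdegT K (fun i => algebraMap (MvPolynomial (Fin 2) K) (RatField 2 K) (h i)) := by
  rw [hf.trdegT_eq, trdegT_substPair hf.isHomogTuple hf.pair_primitive hf.pair_not_const]

theorem isConstTuple_iff_tupleDeg_eq_zero {σ ι : Type*} [Fintype ι] {F : ι → MvPolynomial σ K}
    {D : ℕ} (hD : tupleDeg F = D) : IsConstTuple F ↔ D = 0 := by
  have hle : ∀ {i m}, m ∈ (F i).support → m.degree ≤ D := fun {i m} hm => by
    have h1 : ((m.degree : ℕ) : WithBot ℕ) ≤ D := hD ▸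
      (Finset.le_sup (f := fun m : σ →₀ ℕ => ((m.degree : ℕ) : WithBot ℕ)) hm).trans
      (Finset.le_sup (f := fun i => (F i).support.sup fun d => ((d.degree : ℕ) : WithBot ℕ))
        (Finset.mem_univ i))
    exact_mod_cast h1
  constructor
  · rintro ⟨c, hc⟩
    have h1 : tupleDeg F ≤ (0 : ℕ) := by
      refine Finset.sup_le fun i _ => Finset.sup_le fun m hm => ?_
      rw [hc i] at hm
      have hm' : m = 0 := by
        by_contra hne
        exact mem_support_iff.1 hm (by classical rw [coeff_C, if_neg (Ne.symm hne)])
      rw [hm', map_zero]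
    rw [hD] at h1
    exact Nat.le_zero.1 (by exact_mod_cast h1)
  · rintro rfl
    refine ⟨fun i => coeff 0 (F i), fun i => totalDegree_eq_zero_iff_eq_C.1 ?_⟩
    rw [← Nat.le_zero, totalDegree]
    exact Finset.sup_le fun m hm => hle hm

theorem IsConstTuple.substPair {σ ι : Type*} {h : ι → MvPolynomial (Fin 2) K}
    (hc : IsConstTuple h) (p q : MvPolynomial σ K) : IsConstTuple (substPair h p q) := by
  obtain ⟨c, hc⟩ := hc
  exact ⟨c, fun i => by rw [_root_.substPair, hc i, aeval_C]; rfl⟩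

/-- The degrees of the tuples of a nonzero pair form. -/
theorem IsPairForm.exists_degrees (hf : IsPairForm H g h p q) (h0 : h ≠ 0) :
    ∃ s D d : ℕ, tupleDeg h = s ∧ tupleLowDeg h = s ∧ tupleDeg ![p, q] = D ∧
      tupleLowDeg ![p, q] = d ∧ D ≠ 0 ∧
      tupleDeg (substPair h p q) = (s * D : ℕ) ∧ tupleLowDeg (substPair h p q) = (s * d : ℕ) := by
  obtain ⟨⟨s, hs⟩, hp⟩ := hf.homog_primitive h0
  obtain ⟨D, d, hD, hd, h1, h2⟩ := exists_tupleDeg_substPair hs hp hf.pair_primitive.ne_zero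
  obtain ⟨e, he1, he2⟩ := exists_top_component h0
  obtain ⟨e', he1', he2'⟩ := exists_low_component h0
  have hcomp : ∀ {k}, (∃ i, homogeneousComponent k (h i) ≠ 0) → k = s := by
    rintro k ⟨i, hi⟩
    by_contra hne
    exact hi (by rw [homogeneousComponent_of_mem (hs i), if_neg hne])
  obtain rfl := hcomp he2
  obtain rfl := hcomp he2'
  exact ⟨_, D, d, tupleDeg_eq he1 he2, tupleLowDeg_eq he1' he2', hD, hd,
    fun hD0 => hf.pair_not_const ((isConstTuple_iff_tupleDeg_eq_zero hD).2 hD0), h1, h2⟩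

theorem IsPairForm.tfae_const (hf : IsPairForm H g h p q) :
    List.TFAE [trdegT K H ≤ 1, IsConstTuple (substPair h p q), IsConstTuple h] := by
  tfae_have 1 → 2 := by
    intro h1
    by_cases h0 : h = 0
    · exact ⟨0, fun i => by simp [h0, substPair]⟩
    have hp := hf.primitive_substPair h0
    obtain ⟨i₀, hi₀⟩ := Function.ne_iff.1 hp.ne_zero
    have hinj := IsFractionRing.injective (MvPolynomial (Fin n) K) (RatField n K)
    rw [hf.trdegT_eq] at h1
    choose c hc using div_mem_of_trdegT_le_one (i₀ := i₀) ((map_ne_zero_iff _ hinj).2 hi₀) h1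
    have hc' : ∀ i, substPair h p q i = C (c i) * substPair h p q i₀ := fun i => hinj (by
      rw [hc i, map_mul, IsScalarTower.algebraMap_apply K (MvPolynomial (Fin n) K)]; rfl)
    -- All components are scalar multiples of one of them, which is then a common divisor of a
    -- primitive tuple and hence constant.
    obtain ⟨u, -, hu⟩ := isUnit_iff_eq_C_of_isReduced.1 (hp (substPair h p q i₀) fun i =>
      ⟨C (c i), by rw [hc' i, mul_comm]⟩)
    exact ⟨fun i => c i * u, fun i => by rw [hc' i, hu, C_mul]⟩
  tfae_have 2 → 3 := by
    intro h2
    by_cases h0 : h = 0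
    · exact ⟨0, fun i => by simp [h0]⟩
    obtain ⟨s, D, d, hs, -, -, -, hD, h3, -⟩ := hf.exists_degrees h0
    -- The degree of h(p,q) is sD with D ≠ 0, so it vanishes only for s = 0.
    rw [isConstTuple_iff_tupleDeg_eq_zero h3, Nat.mul_eq_zero, or_iff_left hD] at h2
    exact (isConstTuple_iff_tupleDeg_eq_zero hs).2 h2
  tfae_have 3 → 1 := by
    rintro ⟨c, hc⟩
    rw [hf.trdegT_eq']
    have : ∀ i, algebraMap (MvPolynomial (Fin 2) K) (RatField 2 K) (h i) =
        algebraMap K (RatField 2 K) (c i) := fun i => by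
      rw [hc i, IsScalarTower.algebraMap_apply K (MvPolynomial (Fin 2) K)]; rfl
    rw [funext this]
    exact trdegT_algebraMap_le_one c
  tfae_finish

theorem IsPairForm.isHomogTuple_substPair_iff (hf : IsPairForm H g h p q) (h0 : h ≠ 0) :
    IsHomogTuple (substPair h p q) ↔ IsConstTuple h ∨ IsHomogTuple ![p, q] := by
  obtain ⟨s, D, d, hs, -, hD, hd, hD0, h3, h4⟩ := hf.exists_degrees h0
  rw [isHomogTuple_iff_tupleDeg_eq_tupleLowDeg (hf.primitive_substPair h0).ne_zero h3 h4,
    isHomogTuple_iff_tupleDeg_eq_tupleLowDeg hf.pair_primitive.ne_zero hD hd,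
    isConstTuple_iff_tupleDeg_eq_zero hs, mul_eq_mul_left_iff, or_comm]

end IsPairForm

/-! ### Change of pair and minimal degree -/

theorem exists_C_mul_of_isPrimitiveTuple {K ι : Type*} [Field K] {n : ℕ}
    {F G : ι → MvPolynomial (Fin n) K} (hF : IsPrimitiveTuple F) (hG : IsPrimitiveTuple G)
    {g : RatField n K} (h : ∀ i, algebraMap _ (RatField n K) (F i) = g * algebraMap _ _ (G i)) :
    ∃ c : K, c ≠ 0 ∧ ∀ i, F i = C c * G i := by
  have hinj := IsFractionRing.injective (MvPolynomial (Fin n) K) (RatField n K)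
  obtain ⟨u, v, huv, rfl⟩ :=
    IsFractionRing.exists_reduced_fraction (A := MvPolynomial (Fin n) K) g
  have hv := (map_ne_zero_iff _ hinj).2 (nonZeroDivisors.ne_zero v.2)
  have h' : ∀ i, v.1 * F i = u * G i := fun i => hinj (by
    rw [map_mul, map_mul, h, IsFractionRing.mk'_eq_div, ← mul_assoc, mul_div_cancel₀ _ hv])
  -- With g = u/v reduced, vF = uG makes u a common divisor of F and v one of G.
  have hu : IsUnit u := hF u fun i =>
    IsRelPrime.dvd_of_dvd_mul_left huv ⟨G i, h' i⟩
  have hv : IsUnit v.1 := hG v.1 fun i =>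
    IsRelPrime.dvd_of_dvd_mul_left huv.symm ⟨F i, (h' i).symm⟩
  obtain ⟨a, ha, hau⟩ := isUnit_iff_eq_C_of_isReduced.1 hu
  obtain ⟨b, hb, hbv⟩ := isUnit_iff_eq_C_of_isReduced.1 hv
  refine ⟨b⁻¹ * a, mul_ne_zero (inv_ne_zero hb.ne_zero) ha.ne_zero, fun i => ?_⟩
  rw [C_mul, mul_assoc, ← hau, ← h', hbv, ← mul_assoc, ← C_mul, inv_mul_cancel₀ hb.ne_zero, C_1,
    one_mul]

theorem MvPolynomial.IsHomogeneous.eq_linear {K : Type*} [Field K] {h : MvPolynomial (Fin 2) K}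
    (hh : h.IsHomogeneous 1) : ∃ a b : K, h = C a * X 0 + C b * X 1 := by
  obtain ⟨a, b, hab⟩ :=
    Polynomial.exists_eq_X_add_C_of_natDegree_le_one hh.natDegree_aeval_X_one_le
  refine ⟨a, b, ?_⟩
  rw [← Polynomial.homogenize_eq_of_isHomogeneous hh hab, Polynomial.homogenize_add,
    Polynomial.homogenize_C_mul, Polynomial.homogenize_X one_ne_zero, Polynomial.homogenize_C]
  simp

/-- If two coprime polynomials are linear forms in two others, then the ratio of the latter is a
rational function of the ratio of the former. -/
theorem div_mem_adjoin_of_linear {K : Type*} [Field K] {n : ℕ} {p q p' q' : MvPolynomial (Fin n) K}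
    (hpq : IsPrimitiveTuple ![p, q]) (hc : ¬ IsConstTuple ![p, q]) (hq' : q' ≠ 0)
    {a b c d : K} (hp1 : p = C a * p' + C b * q') (hq1 : q = C c * p' + C d * q') :
    algebraMap _ (RatField n K) p' / algebraMap _ (RatField n K) q' ∈ IntermediateField.adjoin K
      {algebraMap _ (RatField n K) p / algebraMap _ (RatField n K) q} := by
  have hinj := IsFractionRing.injective (MvPolynomial (Fin n) K) (RatField n K)
  have hq := snd_ne_zero_of_pair hpq hc
  have e1 : C d * p - C b * q = C (a * d - b * c) * p' := by
    rw [hp1, hq1]; simp only [C_sub, C_mul]; ring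
  have e2 : C a * q - C c * p = C (a * d - b * c) * q' := by
    rw [hp1, hq1]; simp only [C_sub, C_mul]; ring
  -- If the determinant vanished, linear independence of p and q would kill all four coefficients,
  -- and so q.
  have hdet : a * d - b * c ≠ 0 := by
    intro h0
    rw [h0, C_0, zero_mul, sub_eq_zero] at e1 e2
    have h1 := eq_zero_of_C_mul_eq_C_mul hpq hc e1
    have h2 := eq_zero_of_C_mul_eq_C_mul hpq hc e2.symm
    exact hq (by rw [hq1, h1.1, h2.1]; simp)
  have hq0 := (map_ne_zero_iff _ hinj).2 hq
  have hq0' := (map_ne_zero_iff _ hinj).2 hq'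
  have hCd : algebraMap (MvPolynomial (Fin n) K) (RatField n K) (C (a * d - b * c)) ≠ 0 :=
    (map_ne_zero_iff _ hinj).2 ((map_ne_zero_iff C (C_injective _ _)).2 hdet)
  set E := IntermediateField.adjoin K
    {algebraMap _ (RatField n K) p / algebraMap _ (RatField n K) q}
  have hC : ∀ c : K, algebraMap (MvPolynomial (Fin n) K) (RatField n K) (C c) =
      algebraMap K (RatField n K) c := fun c =>
    (IsScalarTower.algebraMap_apply K (MvPolynomial (Fin n) K) (RatField n K) c).symm
  -- The inverse fractional linear transformation.
  have key : algebraMap _ (RatField n K) p' / algebraMap _ (RatField n K) q' =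
      (algebraMap K (RatField n K) d *
          (algebraMap _ (RatField n K) p / algebraMap _ (RatField n K) q) -
        algebraMap K (RatField n K) b) /
      (algebraMap K (RatField n K) a - algebraMap K (RatField n K) c *
          (algebraMap _ (RatField n K) p / algebraMap _ (RatField n K) q)) := by
    rw [← mul_div_mul_left _ _ hCd, ← map_mul, ← map_mul, ← e1, ← e2, map_sub, map_sub, map_mul,
      map_mul, map_mul, map_mul, hC, hC, hC, hC, ← mul_div_mul_right (_ - algebraMap K _ b) _ hq0, sub_mul, sub_mul,
      mul_assoc, mul_assoc, div_mul_cancel₀ _ hq0]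
  rw [key]
  have hθ := IntermediateField.mem_adjoin_simple_self K
    (algebraMap _ (RatField n K) p / algebraMap _ (RatField n K) q)
  exact div_mem (sub_mem (mul_mem (IntermediateField.algebraMap_mem _ _) hθ)
    (IntermediateField.algebraMap_mem _ _))
    (sub_mem (IntermediateField.algebraMap_mem _ _)
      (mul_mem (IntermediateField.algebraMap_mem _ _) hθ))

/-- A ratio that is a rational function of `p' / q'` arises from `(p', q')` by substitution into
a primitive homogeneous pair. -/
theorem exists_eq_substPair_of_div_mem {K : Type*} [Field K] {n : ℕ}
    {p q p' q' : MvPolynomial (Fin n) K} (hpq : IsPrimitiveTuple ![p, q])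
    (hc : ¬ IsConstTuple ![p, q]) (hpq' : IsPrimitiveTuple ![p', q'])
    (hc' : ¬ IsConstTuple ![p', q'])
    (hmem : algebraMap _ (RatField n K) p / algebraMap _ (RatField n K) q ∈
      IntermediateField.adjoin K
        {algebraMap _ (RatField n K) p' / algebraMap _ (RatField n K) q'}) :
    ∃ k : Fin 2 → MvPolynomial (Fin 2) K, IsHomogTuple k ∧ IsPrimitiveTuple k ∧
      substPair k p' q' = ![p, q] := by
  have hinj := IsFractionRing.injective (MvPolynomial (Fin n) K) (RatField n K)
  have hq := (map_ne_zero_iff _ hinj).2 (snd_ne_zero_of_pair hpq hc)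
  -- The pair (p,q) is itself treated as a tuple to be represented through (p',q'). Both sides are
  -- primitive, so the factor g is a constant, which k absorbs.
  obtain ⟨g, h, hf⟩ := exists_isPairForm_of_div_mem (i₀ := 1)
    (H := fun i => algebraMap _ (RatField n K) (![p, q] i)) hq hpq' hc' (by
      rw [Fin.forall_fin_two]
      refine ⟨hmem, ?_⟩
      change algebraMap _ (RatField n K) q / algebraMap _ (RatField n K) q ∈ _
      rw [div_self hq]
      exact one_mem _)
  have h0 : h ≠ 0 := by
    have h1 : (fun i => algebraMap _ (RatField n K) (![p, q] i)) ≠ 0 := fun h => hq (congrFun h 1)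
    exact (hf.tfae_primitive.out 0 3).1 h1
  obtain ⟨⟨s, hs⟩, hp⟩ := hf.homog_primitive h0
  obtain ⟨c, hc0, hcF⟩ := exists_C_mul_of_isPrimitiveTuple hpq (hf.primitive_substPair h0) hf.eq
  refine ⟨fun i => C c * h i, ⟨s, fun i => (hs i).C_mul c⟩, fun d hd => hp d fun i => ?_, ?_⟩
  · exact (IsUnit.dvd_mul_left (IsUnit.map C hc0.isUnit)).1 (hd i)
  · ext1 i
    rw [hcF i, substPair, map_mul, aeval_C]; rfl

/-- Substituting k into h keeps it homogeneous, and primitive by the same argument as for h(p,q).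
This produces the competitor in the minimality argument. -/
theorem IsPairForm.comp {K : Type*} [Field K] {n m : ℕ} {H : Fin m → RatField n K}
    {g : RatField n K} {h : Fin m → MvPolynomial (Fin 2) K} {p q p' q' : MvPolynomial (Fin n) K}
    (hf : IsPairForm H g h p q) {k : Fin 2 → MvPolynomial (Fin 2) K} (hk : IsHomogTuple k)
    (hkp : IsPrimitiveTuple k) (hk' : substPair k p' q' = ![p, q])
    (hpq' : IsPrimitiveTuple ![p', q']) (hc' : ¬ IsConstTuple ![p', q']) :
    IsPairForm H g (substPair h (k 0) (k 1)) p' q' := by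
  have hk2 : ![k 0, k 1] = k := by ext1 i; fin_cases i <;> rfl
  refine ⟨fun i => ?_, hf.g_ne_zero, ?_, hpq', hc'⟩
  · rw [hf.eq i]
    congr 2
    have : (aeval ![p', q']).comp (aeval ![k 0, k 1]) = aeval (R := K) ![p, q] := by
      rw [← hk', hk2]
      ext1 j
      simp [substPair]
    exact (DFunLike.congr_fun this (h i)).symm
  · by_cases h0 : h = 0
    · exact .inr (by ext1 i; simp [h0, substPair])
    · obtain ⟨⟨s, hs⟩, hp⟩ := hf.homog_primitive h0
      obtain ⟨t, ht⟩ := hk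
      exact .inl ⟨⟨t * s, fun i => (hs i).aeval _ (fun j => hk2.symm ▸ ht j)⟩,
        hp.substPair ⟨s, hs⟩ (hk2.symm ▸ hkp)⟩

theorem IsPairForm.mem_adjoin_of_isAlgebraic {K : Type*} [Field K] {n m : ℕ} (hn : 1 ≤ n)
    {H : Fin m → RatField n K} {g : RatField n K} {h : Fin m → MvPolynomial (Fin 2) K}
    {p q : MvPolynomial (Fin n) K} (hf : IsPairForm H g h p q)
    (hmin : ∀ (g' : RatField n K) (h' : Fin m → MvPolynomial (Fin 2) K)
      (p' q' : MvPolynomial (Fin n) K),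
      IsPairForm H g' h' p' q' → tupleDeg ![p, q] ≤ tupleDeg ![p', q'])
    {z : RatField n K}
    (hz : IsAlgebraic (IntermediateField.adjoin K
      {algebraMap _ (RatField n K) p / algebraMap _ (RatField n K) q}) z) :
    z ∈ IntermediateField.adjoin K
      {algebraMap _ (RatField n K) p / algebraMap _ (RatField n K) q} := by
  have ht := transcendental_div_of_pair hf.pair_primitive hf.pair_not_const
  set θ := algebraMap _ (RatField n K) p / algebraMap _ (RatField n K) q with hθ
  set E := IntermediateField.adjoin K {θ} with hE
  let A := algebraicClosure E (RatField n K)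
  let M := A.restrictScalars K
  -- M is algebraic over K(θ), so it is again generated by one element.
  have hM : Algebra.trdeg K M ≤ 1 := by
    have _ : FaithfulSMul E A :=
      (faithfulSMul_iff_algebraMap_injective _ _).2 (algebraMap E A).injective
    have h1 := trdeg_add_eq K E (A := A)
    rw [IntermediateField.trdeg_adjoin_simple_of_transcendental ht,
      trdeg_eq_zero_iff.2 (algebraicClosure.isAlgebraic E (RatField n K)), add_zero] at h1
    exact h1.ge
  obtain ⟨w, hw⟩ := RatField.exists_eq_adjoin_of_trdeg_le_one M hM
  obtain ⟨p', q', hpq', hc', hw'⟩ := exists_pair_mem_adjoin hn w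
  have hMle : M ≤ IntermediateField.adjoin K
      {algebraMap _ (RatField n K) p' / algebraMap _ (RatField n K) q'} := by
    rw [hw]; exact IntermediateField.adjoin_simple_le_iff.2 hw'
  have hzM : z ∈ M := (mem_algebraicClosure_iff (F := E)).2 hz
  have hθM : θ ∈ M := (mem_algebraicClosure_iff (F := E)).2
    (isAlgebraic_algebraMap (⟨θ, IntermediateField.mem_adjoin_simple_self K θ⟩ : E))
  obtain ⟨k, hk, hkp, hk'⟩ := exists_eq_substPair_of_div_mem hf.pair_primitive hf.pair_not_const
    hpq' hc' (hMle hθM)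
  have hle := hmin _ _ _ _ (hf.comp hk hkp hk' hpq' hc')
  obtain ⟨s, hs⟩ := hk
  obtain ⟨D, d, hD, -, h1, -⟩ := exists_tupleDeg_substPair hs hkp hpq'.ne_zero
  rw [hk'] at h1
  rw [h1, hD] at hle
  have hle' : s * D ≤ D := by exact_mod_cast hle
  have hsD : s * D ≠ 0 := fun h0 =>
    hf.pair_not_const ((isConstTuple_iff_tupleDeg_eq_zero h1).2 h0)
  -- The degree of (p,q) is sD, where D is that of (p',q'). Minimality gives sD ≤ D, while sD ≠ 0 as
  -- (p,q) is not constant.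
  obtain rfl : s = 1 := by
    have hD0 := right_ne_zero_of_mul hsD
    have hs0 := left_ne_zero_of_mul hsD
    have : s ≤ 1 := Nat.le_of_mul_le_mul_right (by simpa using hle') (Nat.pos_of_ne_zero hD0)
    omega
  obtain ⟨a, b, hab⟩ := (hs 0).eq_linear
  obtain ⟨c, e, hce⟩ := (hs 1).eq_linear
  have hp1 : p = C a * p' + C b * q' := by
    rw [show p = substPair k p' q' 0 by rw [hk']; rfl, substPair, hab]
    simp [MvPolynomial.algebraMap_eq]
  have hq1 : q = C c * p' + C e * q' := by
    rw [show q = substPair k p' q' 1 by rw [hk']; rfl, substPair, hce]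
    simp [MvPolynomial.algebraMap_eq]
  exact IntermediateField.adjoin_simple_le_iff.2
    (div_mem_adjoin_of_linear hf.pair_primitive hf.pair_not_const
      (snd_ne_zero_of_pair hpq' hc') hp1 hq1) (hMle hzM)

theorem mainTheorem1 {K : Type*} [Field K] (n m : ℕ) (hn : 1 ≤ n) (hm : 1 ≤ m)
    (H : Fin m → RatField n K) (hH : trdegT K H ≤ 2) :
    (∃ (g : RatField n K) (h : Fin m → MvPolynomial (Fin 2) K) (p q : MvPolynomial (Fin n) K),
      IsPairForm H g h p q) ∧
    ∀ (g : RatField n K) (h : Fin m → MvPolynomial (Fin 2) K) (p q : MvPolynomial (Fin n) K),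
      IsPairForm H g h p q →
      -- transcendence degrees
      (trdegT K H = trdegT K (fun i => algebraMap (MvPolynomial (Fin n) K) (RatField n K)
          (substPair h p q i)) ∧
        trdegT K H = trdegT K (fun i => algebraMap (MvPolynomial (Fin 2) K) (RatField 2 K)
          (h i))) ∧
      -- primitivity
      List.TFAE [H ≠ 0, IsPrimitiveTuple (substPair h p q), IsPrimitiveTuple h, h ≠ 0] ∧
      -- the case of transcendence degree at most one
      List.TFAE [trdegT K H ≤ 1, IsConstTuple (substPair h p q), IsConstTuple h] ∧
      -- degrees
      (h ≠ 0 → ∃ s : ℕ, tupleDeg h = s ∧ tupleLowDeg h = s ∧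
        tupleDeg (substPair h p q) = s * tupleDeg ![p, q] ∧
        tupleLowDeg (substPair h p q) = s * tupleLowDeg ![p, q]) ∧
      -- homogeneity
      (h ≠ 0 → (IsHomogTuple (substPair h p q) ↔ IsConstTuple h ∨ IsHomogTuple ![p, q])) ∧
      -- algebraic closedness
      ((∀ (g' : RatField n K) (h' : Fin m → MvPolynomial (Fin 2) K)
          (p' q' : MvPolynomial (Fin n) K),
          IsPairForm H g' h' p' q' → tupleDeg ![p, q] ≤ tupleDeg ![p', q']) →
        ∀ z : RatField n K,
          IsAlgebraic (IntermediateField.adjoin K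
            {algebraMap (MvPolynomial (Fin n) K) (RatField n K) p /
              algebraMap (MvPolynomial (Fin n) K) (RatField n K) q}) z →
          z ∈ IntermediateField.adjoin K
            {algebraMap (MvPolynomial (Fin n) K) (RatField n K) p /
              algebraMap (MvPolynomial (Fin n) K) (RatField n K) q}) := by
  refine ⟨exists_isPairForm hn H hH, fun g h p q hf => ⟨⟨hf.trdegT_eq, hf.trdegT_eq'⟩,
    hf.tfae_primitive, hf.tfae_const, fun h0 => ?_, hf.isHomogTuple_substPair_iff,
    fun hmin z hz => hf.mem_adjoin_of_isAlgebraic hn hmin hz⟩⟩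
  obtain ⟨s, D, d, hs, hs', hD, hd, -, h1, h2⟩ := hf.exists_degrees h0
  exact ⟨s, hs, hs', by rw [h1, hD]; norm_cast, by rw [h2, hd]; norm_cast⟩
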